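/- An extended-real-valued function $h:\mathbb R^n\to\mathbb R\cup\{\infty\}$ is proper if it is not identically $\infty$, and a proper function is closed if it is lower semicontinuous. Its regular subdifferential $\hat\partial h(x)$ at a point $x$ with $h(x)<\infty$ is the set of $\zeta$ with $\liminf_{z\to x,\,z\ne x}\frac{h(z)-h(x)-\langle\zeta,z-x\rangle}{\|z-x\|}\ge 0$. Its subdifferential $\partial h(x)$ is the set of limits $\zeta=\lim_k\zeta^k$ with $\zeta^k\in\hat\partial h(x^k)$, $x^k\to x$ and $h(x^k)\to h(x)$ (both sets are empty where $h(x)=\infty$), and $\mathrm{dom}\,\partial h=\{x:\partial h(x)\neq\emptyset\}$. For $\alpha\in[0,1)$, a proper closed function $h$ satisfies the Kurdyka–Łojasiewicz (KL) property with exponent $\alpha$ at $\bar x\in\mathrm{dom}\,\partial h$ if there are $c>0$, $a\in(0,\infty]$ and a neighbourhood $V$ of $\bar x$ such that, with $\varphi(s)=c\,s^{1-\alpha}$, $$\varphi'\big(h(x)-h(\bar x)\big)\,\mathrm{dist}\big(0,\partial h(x)\big)\ge 1\quad\text{for all }x\in V\text{ with }h(\bar x)<h(x)<h(\bar x)+a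 ,$$ where $\mathrm{dist}(0,\emptyset)=\infty$. All norms are Euclidean, $\mathcal S^d$ is the space of real symmetric $d\times d$ matrices, and $\mathrm{ri}$ denotes the relative interior. **Theorem (KL exponent of sums of LMI-representable functions).** Let $f=\sum_{i=1}^m f_i$, where each $f_i:\mathbb R^n\to\mathbb R\cup\{\infty\}$ is proper and closed. Suppose that each $f_i$ is LMI-representable: there are $d_i\ge 1$ and matrices $A^i_{00},A^i_0,A^i_1,\dots,A^i_n\in\mathcal S^{d_i}$ such that $$\mathrm{epi}\,f_i=\Big\{(x,t)\in\mathbb R^n\times\mathbb R:\ A^i_{00}+\sum_{j=1}^n A^i_jx_j+A^i_0t\succeq 0\Big\}.$$ Suppose also that there are $x^s\in\mathbb R^n$ and $s^s\in\mathbb R^m$ such that $A^i_{00}+\sum_{j=1}^n A^i_jx^s_j+A^i_0s^s_i\succ 0$ for $i=1,\dots,m$. If $\bar x\in\mathrm{dom}\,\partial f$ satisfies $0\in\mathrm{ri}\,\partial f(\bar x)$, then $f$ satisfies the KL property at $\bar x$ with exponent $\frac12$. In particular, each of the following functions $f$ satisfies the KL property with exponent $\frac12$ at every $\bar x$ with $0\in\mathrm{ri}\,\partial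 f(\bar x)$. Here $A\in\mathbb R^{p\times n}$, $b\in\mathbb R^p$, and $x_J$ is the subvector of $x$ indexed by $J\subseteq\{1,\dots,n\}$. 1. (Group Lasso with overlapping blocks) $f(x)=\frac12\|Ax-b\|^2+\sum_{i=1}^s w_i\|x_{J_i}\|$, where $J_i\subseteq\{1,\dots,n\}$, $\bigcup_{i=1}^s J_i=\{1,\dots,n\}$ and $w_i\ge 0$; the $J_i$ may overlap. 2. (Group fused Lasso) $f(x)=\frac12\|Ax-b\|^2+\sum_{i=1}^s w_i\|x_{J_i}\|+\sum_{i=2}^s\nu_i\|x_{J_i}-x_{J_{i-1}}\|$, where $s\ge 1$, the sets $J_1,\dots,J_s$ are pairwise disjoint with union $\{1,\dots,n\}$ and have the same cardinality $r$, and $w_i,\nu_i\ge 0$. -/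

import Mathlib

open Filter Topology

namespace KLLMI

/-- `ℝⁿ` with its Euclidean structure. -/
abbrev E (n : ℕ) : Type := EuclideanSpace ℝ (Fin n)

/-- The domain of an extended-real-valued function. -/
def dom {n : ℕ} (f : E n → EReal) : Set (E n) := {x | f x < ⊤}

/-- The epigraph of an extended-real-valued function, a subset of `ℝⁿ × ℝ`. -/
def epi {n : ℕ} (f : E n → EReal) : Set (E n × ℝ) := {p | f p.1 ≤ (p.2 : EReal)}

/-- Properness: the domain is nonempty and the value `-∞` is never taken. -/
def Proper {n : ℕ} (f : E n → EReal) : Prop := (dom f).Nonempty ∧ ∀ x, f x ≠ ⊥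

/-- A closed proper function: proper and lower semicontinuous. -/
def ProperClosed {n : ℕ} (f : E n → EReal) : Prop := Proper f ∧ LowerSemicontinuous f

/-- The regular (Fréchet) subdifferential; it is empty outside the domain. The quotient and the
lower limit are taken in the extended reals. -/
def regularSubdifferential {n : ℕ} (f : E n → EReal) (x : E n) : Set (E n) :=
  {ζ | x ∈ dom f ∧
    0 ≤ liminf (fun z : E n =>
      (f z - f x - ((inner ℝ ζ (z - x) : ℝ) : EReal)) / ((‖z - x‖ : ℝ) : EReal)) (𝓝[≠] x)}

/-- The (limiting) subdifferential; it is empty outside the domain. -/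
def subdifferential {n : ℕ} (f : E n → EReal) (x : E n) : Set (E n) :=
  {ζ | x ∈ dom f ∧ ∃ u v : ℕ → E n,
    Tendsto u atTop (𝓝 x) ∧ Tendsto (fun k => f (u k)) atTop (𝓝 (f x)) ∧
    Tendsto v atTop (𝓝 ζ) ∧ ∀ k, v k ∈ regularSubdifferential f (u k)}

/-- The domain of the subdifferential. -/
def domSubdifferential {n : ℕ} (f : E n → EReal) : Set (E n) :=
  {x | (subdifferential f x).Nonempty}

/-- The Kurdyka–Łojasiewicz inequality at `x₀` for the function `φ`: there are `a ∈ (0, ∞]` and a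
neighbourhood `V` of `x₀` such that `φ'(h(x) - h(x₀)) · dist(0, ∂h(x)) ≥ 1` for all `x ∈ V` with
`h(x₀) < h(x) < h(x₀) + a`. The distance is extended-valued: it is `∞` to the empty set. -/
def KLInequality {n : ℕ} (h : E n → EReal) (x₀ : E n) (φ : ℝ → ℝ) : Prop :=
  ∃ a : EReal, 0 < a ∧ ∃ V ∈ 𝓝 x₀, ∀ x ∈ V, h x₀ < h x → h x < h x₀ + a →
    1 ≤ ENNReal.ofReal (deriv φ (h x - h x₀).toReal) * Metric.infEDist 0 (subdifferential h x)

/-- The proper closed function `h` has the Kurdyka–Łojasiewicz property at `x₀ ∈ dom ∂h` with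
exponent `α ∈ [0, 1)`: the inequality holds with `φ(s) = c s ^ (1 - α)` for some `c > 0`. (Such a
`φ` is continuous and concave on `[0, ∞)`, vanishes at `0`, and is `C¹` with positive derivative
on `(0, ∞)`.) -/
def HasKLExponent {n : ℕ} (h : E n → EReal) (x₀ : E n) (α : ℝ) : Prop :=
  ProperClosed h ∧ x₀ ∈ domSubdifferential h ∧ 0 ≤ α ∧ α < 1 ∧
    ∃ c : ℝ, 0 < c ∧ KLInequality h x₀ (fun s => c * s ^ (1 - α))

/-- The affine matrix expression `A₀₀ + ∑ⱼ xⱼ Aⱼ + t A₀`. -/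
def pencil {n d : ℕ} (A₀₀ A₀ : Matrix (Fin d) (Fin d) ℝ) (A : Fin n → Matrix (Fin d) (Fin d) ℝ)
    (x : E n) (t : ℝ) : Matrix (Fin d) (Fin d) ℝ :=
  A₀₀ + ∑ j, x j • A j + t • A₀

/-- The symmetric `d × d` matrices `A₀₀, A₀, A₁, …, Aₙ` (with `d ≥ 1`) form an LMI representation
of `h`: the epigraph of `h` is the solution set of the linear matrix inequality
`A₀₀ + ∑ⱼ xⱼ Aⱼ + t A₀ ⪰ 0`. -/
structure IsLMIRepresentation {n d : ℕ} (h : E n → EReal) (A₀₀ A₀ : Matrix (Fin d) (Fin d) ℝ)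
    (A : Fin n → Matrix (Fin d) (Fin d) ℝ) : Prop where
  one_le : 1 ≤ d
  symm₀₀ : A₀₀.IsSymm
  symm₀ : A₀.IsSymm
  symm : ∀ j, (A j).IsSymm
  epi_eq : epi h = {p : E n × ℝ | (pencil A₀₀ A₀ A p.1 p.2).PosSemidef}

/-- The least squares loss `½ ‖Ax - b‖²`. -/
noncomputable def leastSquares {n p : ℕ} (A : Matrix (Fin p) (Fin n) ℝ) (b : E p) (x : E n) : ℝ :=
  1 / 2 * ‖WithLp.toLp 2 (A.mulVec x.ofLp) - b‖ ^ 2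

/-- The subvector `x_J` of `x` indexed by `J`, its entries taken in increasing order of index. -/
noncomputable def subvector {n r : ℕ} (J : Finset (Fin n)) (hJ : J.card = r) (x : E n) : E r :=
  WithLp.toLp 2 (fun k => x (J.orderEmbOfFin hJ k))

/-- The group Lasso objective `½ ‖Ax - b‖² + ∑ᵢ wᵢ ‖x_{Jᵢ}‖`; the blocks `Jᵢ` may overlap. -/
noncomputable def groupLasso {n p s : ℕ} (A : Matrix (Fin p) (Fin n) ℝ) (b : E p)
    (J : Fin s → Finset (Fin n)) (w : Fin s → ℝ) (x : E n) : EReal :=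
  ((leastSquares A b x + ∑ i, w i * ‖subvector (J i) rfl x‖ : ℝ) : EReal)

/-- The group fused Lasso objective with `s + 1` blocks `J₀, …, J_s`, each of size `r`:
`½ ‖Ax - b‖² + ∑_{i ≤ s} wᵢ ‖x_{Jᵢ}‖ + ∑_{1 ≤ i ≤ s} νᵢ ‖x_{Jᵢ} - x_{Jᵢ₋₁}‖`
(here `νᵢ` is stored at position `i - 1`). -/
noncomputable def groupFusedLasso {n p s r : ℕ} (A : Matrix (Fin p) (Fin n) ℝ) (b : E p)
    (J : Fin (s + 1) → Finset (Fin n)) (hJ : ∀ i, (J i).card = r)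
    (w : Fin (s + 1) → ℝ) (ν : Fin s → ℝ) (x : E n) : EReal :=
  ((leastSquares A b x + ∑ i, w i * ‖subvector (J i) (hJ i) x‖
    + ∑ i : Fin s, ν i * ‖subvector (J i.succ) (hJ i.succ) x
        - subvector (J i.castSucc) (hJ i.castSucc) x‖ : ℝ) : EReal)

end KLLMI

/-! Lift the sum to the variables `(x, t)` with one height `t i` per summand. The conditions `f i x
≤ t i` together form one block-diagonal, strictly feasible inequality: the form `B₀ + D (x, t)` is
positive semidefinite. Let `B` be this form at `x₀` with tight heights, and let `σ` be the sum of
the heights. The tangent cone consists of the `h` with `D h ≥ 0` on the kernel of `B`, and `0 ∈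
∂f(x₀)` says that `σ ≥ 0` on it. The relative interior condition upgrades this to strict
complementarity: tangent directions of zero cost form a linear space
(`neg_mem_formTangent_of_sum_nonpos`).

This yields a square-root error bound (`exists_form_error_bound`). On the kernel of `B` the diagonal
of `D h` is `O(σ h)`. By Cauchy–Schwarz for the semidefinite form `B + D h`, the full rows of `D h`
over that kernel are `O(√(σ h))`. Hoffman's bound then moves `h` by `O(√(σ h))` to some `k` whose
rows vanish there; such a small `k` is feasible with `σ k = 0`, so it gives a minimiser.

Finally, if `y` is a minimiser with `‖x - y‖ ≤ C √(f x - f x₀)` and `ζ ∈ ∂f(x)`, convexity gives `f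
x - f x₀ ≤ ⟨ζ, x - y⟩ ≤ C ‖ζ‖ √(f x - f x₀)`, which is the KL inequality with exponent `1/2`
(`hasKLExponent_sum`). For the Lasso models it remains to represent squared norms and norms by
quadratic forms. -/

namespace KLLMI

set_option maxSynthPendingDepth 3

/-! ### Perturbation of semidefinite forms and the square-root error bound. -/

section Forms

variable {X W : Type*} [NormedAddCommGroup X] [NormedSpace ℝ X] [FiniteDimensional ℝ X]
  [NormedAddCommGroup W] [NormedSpace ℝ W] [FiniteDimensional ℝ W]

/-- On a closed cone in a finite-dimensional space, a continuous positively homogeneous function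
that is positive away from the origin dominates a multiple of the norm. -/
theorem exists_pos_mul_norm_le_of_cone {C : Set X} (hC : IsClosed C)
    (hs : ∀ h ∈ C, ∀ s : ℝ, 0 < s → s • h ∈ C) {g : X → ℝ} (hg : Continuous g)
    (hom : ∀ s : ℝ, 0 < s → ∀ h, g (s • h) = s * g h) (g0 : 0 ≤ g 0)
    (pos : ∀ h ∈ C, h ≠ 0 → 0 < g h) : ∃ c > 0, ∀ h ∈ C, c * ‖h‖ ≤ g h := by
  have hK : IsCompact (C ∩ Metric.sphere (0 : X) 1) := (isCompact_sphere _ _).inter_left hC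
  obtain ⟨c, hc, hcg⟩ := hK.exists_forall_le' hg.continuousOn (a := 0) (by
    rintro b ⟨hb, hb1⟩
    exact pos b hb (by rintro rfl; simp at hb1))
  refine ⟨c, hc, fun h hh => ?_⟩
  rcases eq_or_ne h 0 with rfl | h0
  · simpa using g0
  have hn : 0 < ‖h‖ := norm_pos_iff.2 h0
  have h1 := hcg (‖h‖⁻¹ • h) ⟨hs h hh _ (by positivity), by
    simp [norm_smul, hn.ne']⟩
  rw [hom _ (by positivity)] at h1
  rwa [inv_mul_eq_div, le_div_iff₀ hn] at h1

/-- The image of a closed cone under a linear map whose kernel meets the cone only at the origin is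
closed. -/
theorem isClosed_image_of_cone {Y : Type*} [NormedAddCommGroup Y] [NormedSpace ℝ Y]
    {C : Set X} (hC : IsClosed C) (hs : ∀ h ∈ C, ∀ s : ℝ, 0 < s → s • h ∈ C) (A : X →L[ℝ] Y)
    (hA : ∀ h ∈ C, A h = 0 → h = 0) : IsClosed (A '' C) := by
  -- The lower bound `c * ‖h‖ ≤ ‖A h‖` on the cone keeps preimages of a convergent sequence bounded.
  obtain ⟨c, hc, hcA⟩ := exists_pos_mul_norm_le_of_cone hC hs (g := fun h => ‖A h‖) (by fun_prop)
    (by intro s hs h; simp [norm_smul, abs_of_pos hs]) (by simp)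
    (fun h hh h0 => norm_pos_iff.2 (mt (hA h hh) h0))
  refine IsSeqClosed.isClosed ?_
  intro y y₀ hy hlim
  choose x hx hxy using hy
  obtain ⟨M, hM⟩ := (Metric.isBounded_range_of_tendsto _ hlim).exists_norm_le
  have hb : ∀ k, x k ∈ Metric.closedBall (0 : X) (M / c) := by
    intro k
    rw [mem_closedBall_zero_iff, le_div_iff₀ hc, mul_comm]
    exact (hcA _ (hx k)).trans (by rw [hxy]; exact hM _ ⟨k, rfl⟩)
  obtain ⟨x₀, -, φ, hφ, hx₀⟩ := (isCompact_closedBall (0 : X) (M / c)).tendsto_subseq hb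
  refine ⟨x₀, hC.mem_of_tendsto hx₀ (Eventually.of_forall fun k => hx _), ?_⟩
  refine tendsto_nhds_unique ((A.continuous.tendsto x₀).comp hx₀) ?_
  simpa [Function.comp_def, hxy] using hlim.comp hφ.tendsto_atTop

omit [FiniteDimensional ℝ W] in
/-- Cauchy–Schwarz for a positive semidefinite symmetric form. -/
theorem form_sq_le {B : W →L[ℝ] W →L[ℝ] ℝ} (hB : ∀ w, 0 ≤ B w w)
    (hsymm : ∀ v w, B v w = B w v) (v w : W) : B v w ^ 2 ≤ B v v * B w w := by
  have := LinearMap.BilinForm.apply_sq_le_of_symm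
    (LinearMap.mk₂ ℝ (fun v w => B v w) (by simp) (by simp) (by simp) (by simp)) hB
    ⟨fun v w => by simpa using hsymm v w⟩ v w
  simpa using this

omit [FiniteDimensional ℝ W] in
theorem form_eq_zero {B : W →L[ℝ] W →L[ℝ] ℝ} (hB : ∀ w, 0 ≤ B w w)
    (hsymm : ∀ v w, B v w = B w v) {v : W} (hv : B v v = 0) : B v = 0 := by
  ext w
  have := form_sq_le hB hsymm v w
  rw [hv, zero_mul] at this
  simpa using pow_eq_zero_iff two_ne_zero |>.1 (le_antisymm this (sq_nonneg _))

/-- A positive semidefinite form stays positive semidefinite under small perturbations in a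
direction that is positive definite on its kernel. -/
theorem exists_forall_form_add_smul_nonneg {B D : W →L[ℝ] W →L[ℝ] ℝ} (hB : ∀ w, 0 ≤ B w w)
    (hsymm : ∀ v w, B v w = B w v) (hD : ∀ u, u ≠ 0 → B u = 0 → 0 < D u u) :
    ∃ s₀ > 0, ∀ s : ℝ, 0 < s → s ≤ s₀ → ∀ w, 0 ≤ B w w + s * D w w := by
  -- Only vectors with `D w w ≤ 0` matter. Those of unit length form a compact set that misses the
  -- kernel of `B`, so `B w w ≥ c > 0` there.
  have hK : IsCompact ({w | D w w ≤ 0} ∩ Metric.sphere (0 : W) 1) :=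
    (isCompact_sphere _ _).inter_left (isClosed_le (by fun_prop) continuous_const)
  obtain ⟨c, hc, hcB⟩ := hK.exists_forall_le' (f := fun w => B w w) (by fun_prop) (a := 0) (by
    rintro w ⟨hw, hw1⟩
    refine lt_of_le_of_ne (hB w) fun h => ?_
    have hw0 : w ≠ 0 := by rintro rfl; simp at hw1
    exact absurd (hD w hw0 (form_eq_zero hB hsymm h.symm)) (not_lt.2 hw))
  refine ⟨c / (‖D‖ + 1), by positivity, fun s hs hs' w => ?_⟩
  rcases le_or_gt 0 (D w w) with h | h
  · have := hB w; positivity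
  have hw0 : w ≠ 0 := by rintro rfl; simp at h
  have hn : 0 < ‖w‖ := norm_pos_iff.2 hw0
  have h1 := hcB (‖w‖⁻¹ • w) ⟨by
    simp only [map_smul, smul_apply, smul_eq_mul, Set.mem_ofPred_eq]
    have : 0 ≤ ‖w‖⁻¹ * ‖w‖⁻¹ := by positivity
    nlinarith, by simp [norm_smul, hn.ne']⟩
  simp only [map_smul, smul_apply, smul_eq_mul] at h1
  have h2 : c * (‖w‖ * ‖w‖) ≤ B w w := by
    have := mul_le_mul_of_nonneg_right h1 (by positivity : 0 ≤ ‖w‖ * ‖w‖)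
    calc _ ≤ _ := this
      _ = B w w := by field_simp
  have h3 : |D w w| ≤ ‖D‖ * ‖w‖ * ‖w‖ := D.le_opNorm₂ w w
  have h4 : s * (‖D‖ + 1) ≤ c := by rwa [le_div_iff₀ (by positivity)] at hs'
  have h5 := neg_le_of_abs_le h3
  have h6 : s * ‖D‖ * (‖w‖ * ‖w‖) ≤ c * (‖w‖ * ‖w‖) :=
    mul_le_mul_of_nonneg_right (by linarith) (by positivity)
  nlinarith

/-- A positive semidefinite form stays positive semidefinite under small symmetric perturbations
that vanish on its kernel. -/
theorem exists_forall_form_add_nonneg {B : W →L[ℝ] W →L[ℝ] ℝ} (hB : ∀ w, 0 ≤ B w w)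
    (hsymm : ∀ v w, B v w = B w v) :
    ∃ ρ > 0, ∀ D : W →L[ℝ] W →L[ℝ] ℝ, ‖D‖ < ρ → (∀ v w, D v w = D w v) →
      (∀ u, B u = 0 → D u = 0) → ∀ w, 0 ≤ B w w + D w w := by
  -- The form `B + D` sees only the component in a complement `R` of the kernel, where `B` is
  -- coercive; the coercivity constant serves as `ρ`.
  obtain ⟨R, hR⟩ := Submodule.exists_isCompl (LinearMap.ker (B : W →ₗ[ℝ] W →L[ℝ] ℝ))
  have hK : IsCompact ((R : Set W) ∩ Metric.sphere (0 : W) 1) :=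
    (isCompact_sphere _ _).inter_left R.closed_of_finiteDimensional
  obtain ⟨c, hc, hcB⟩ := hK.exists_forall_le' (f := fun w => B w w) (by fun_prop) (a := 0) (by
    rintro w ⟨hw, hw1⟩
    refine lt_of_le_of_ne (hB w) fun h => ?_
    have h0 : w = 0 := Submodule.disjoint_def.1 hR.disjoint w
      (by simpa using form_eq_zero hB hsymm h.symm) hw
    simp [h0] at hw1)
  refine ⟨c, hc, fun D hD hDs hD0 w => ?_⟩
  obtain ⟨u, hu, r, hr, rfl⟩ := Submodule.mem_sup.1
    (show w ∈ LinearMap.ker (B : W →ₗ[ℝ] W →L[ℝ] ℝ) ⊔ R by rw [hR.sup_eq_top]; trivial)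
  have hu' : B u = 0 := by simpa using hu
  have e1 : B (u + r) (u + r) = B r r := by simp [hu', hsymm r u]
  have e2 : D (u + r) (u + r) = D r r := by simp [hD0 u hu', hDs r u]
  rw [e1, e2]
  rcases eq_or_ne r 0 with rfl | h0
  · simp
  have hn : 0 < ‖r‖ := norm_pos_iff.2 h0
  have h1 := hcB (‖r‖⁻¹ • r) ⟨R.smul_mem _ hr, by simp [norm_smul, hn.ne']⟩
  simp only [map_smul, smul_apply, smul_eq_mul] at h1
  have h2 : c * (‖r‖ * ‖r‖) ≤ B r r := by
    have := mul_le_mul_of_nonneg_right h1 (by positivity : 0 ≤ ‖r‖ * ‖r‖)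
    calc _ ≤ _ := this
      _ = B r r := by field_simp
  have h3 : |D r r| ≤ ‖D‖ * ‖r‖ * ‖r‖ := D.le_opNorm₂ r r
  have h5 := neg_le_of_abs_le h3
  have : ‖D‖ * (‖r‖ * ‖r‖) ≤ c * (‖r‖ * ‖r‖) := by gcongr
  linarith

/-- Hoffman's bound for linear equations: the distance to the kernel of a linear map is controlled
by the norm of the value. -/
theorem exists_ker_norm_sub_le {G : Type*} [NormedAddCommGroup G]
    [NormedSpace ℝ G] (A : X →L[ℝ] G) :
    ∃ C > 0, ∀ h, ∃ k, A k = 0 ∧ ‖h - k‖ ≤ C * ‖A h‖ := by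
  obtain ⟨R, hR⟩ := Submodule.exists_isCompl (LinearMap.ker (A : X →ₗ[ℝ] G))
  obtain ⟨c, hc, hcA⟩ := exists_pos_mul_norm_le_of_cone (C := (R : Set X))
    R.closed_of_finiteDimensional (fun h hh s _ => R.smul_mem s hh) (g := fun h => ‖A h‖)
    (by fun_prop) (by intro s hs h; simp [norm_smul, abs_of_pos hs]) (by simp)
    (fun h hh h0 => norm_pos_iff.2 fun h1 => h0
      (Submodule.disjoint_def.1 hR.disjoint h (by simpa using h1) hh))
  refine ⟨c⁻¹, by positivity, fun h => ?_⟩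
  obtain ⟨k, hk, r, hr, rfl⟩ := Submodule.mem_sup.1
    (show h ∈ LinearMap.ker (A : X →ₗ[ℝ] G) ⊔ R by rw [hR.sup_eq_top]; trivial)
  have hk' : A k = 0 := by simpa using hk
  refine ⟨k, hk', ?_⟩
  rw [add_sub_cancel_left, map_add, hk', zero_add, inv_mul_eq_div, le_div_iff₀ hc, mul_comm]
  exact hcA r hr

/-- The tangent cone, in the parameter space, of the positive semidefinite cone along an affine
family of forms with linear part `D` passing through the form `B`. -/
def formTangent (B : W →L[ℝ] W →L[ℝ] ℝ) (D : X →L[ℝ] W →L[ℝ] W →L[ℝ] ℝ) : Set X :=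
  {h | ∀ u, B u = 0 → 0 ≤ D h u u}

variable {B : W →L[ℝ] W →L[ℝ] ℝ} {D : X →L[ℝ] W →L[ℝ] W →L[ℝ] ℝ}

omit [FiniteDimensional ℝ X] [FiniteDimensional ℝ W] in
theorem isClosed_formTangent : IsClosed (formTangent B D) := by
  simp only [formTangent, Set.ofPred_forall]
  exact isClosed_iInter fun u => isClosed_iInter fun _ =>
    isClosed_le continuous_const (by fun_prop)

omit [FiniteDimensional ℝ X] [FiniteDimensional ℝ W] in
theorem smul_mem_formTangent {h : X} (hh : h ∈ formTangent B D) {s : ℝ} (hs : 0 ≤ s) :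
    s • h ∈ formTangent B D := by
  intro u hu
  have := hh u hu
  simp only [map_smul, smul_apply, smul_eq_mul]
  positivity

omit [FiniteDimensional ℝ X] [FiniteDimensional ℝ W] in
theorem add_mem_formTangent {h k : X} (hh : h ∈ formTangent B D) (hk : k ∈ formTangent B D) :
    h + k ∈ formTangent B D := by
  intro u hu
  have := hh u hu
  have := hk u hu
  simp only [map_add, add_apply]
  positivity

omit [FiniteDimensional ℝ W] in
/-- If a linear functional is nonnegative on the tangent cone and vanishes only on its lineality
space, then it controls the tangential part of the forms. -/
theorem exists_form_le_mul (σ : X →L[ℝ] ℝ)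
    (hσ : ∀ h ∈ formTangent B D, 0 ≤ σ h)
    (hσ0 : ∀ h ∈ formTangent B D, σ h = 0 → -h ∈ formTangent B D) :
    ∃ C > 0, ∀ h ∈ formTangent B D, ∀ u, B u = 0 → D h u u ≤ C * σ h * ‖u‖ ^ 2 := by
  -- `N` is the lineality space of the tangent cone. There `σ` vanishes, and on the part of the cone
  -- in a complement `σ` is positive off the origin, hence dominates the norm.
  let N : Submodule ℝ X :=
    { carrier := {h | ∀ u, B u = 0 → D h u u = 0}
      zero_mem' := by simp
      add_mem' := fun {a b} ha hb u hu => by simp [ha u hu, hb u hu]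
      smul_mem' := fun s a ha u hu => by simp [ha u hu] }
  obtain ⟨R, hR⟩ := Submodule.exists_isCompl N
  have hN : ∀ k ∈ N, k ∈ formTangent B D := fun k hk u hu => (hk u hu).ge
  have hNσ : ∀ k ∈ N, σ k = 0 := fun k hk => by
    have h1 := hσ k (hN k hk)
    have h2 := hσ (-k) (hN _ (N.neg_mem hk))
    rw [map_neg] at h2
    linarith
  obtain ⟨c, hc, hcσ⟩ := exists_pos_mul_norm_le_of_cone (C := formTangent B D ∩ R)
    (isClosed_formTangent.inter R.closed_of_finiteDimensional)
    (fun h hh s hs => ⟨smul_mem_formTangent hh.1 hs.le, R.smul_mem s hh.2⟩) (g := σ)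
    σ.continuous (by simp) (by simp) (by
      rintro h ⟨hT, hhR⟩ h0
      refine lt_of_le_of_ne (hσ h hT) fun h1 => h0 (Submodule.disjoint_def.1 hR.disjoint h ?_ hhR)
      intro u hu
      have h2 := hT u hu
      have h3 := hσ0 h hT h1.symm u hu
      simp only [map_neg, neg_apply] at h3
      linarith)
  refine ⟨(‖D‖ + 1) / c, by positivity, fun h hh u hu => ?_⟩
  obtain ⟨k, hk, r, hr, rfl⟩ := Submodule.mem_sup.1
    (show h ∈ N ⊔ R by rw [hR.sup_eq_top]; trivial)
  have hrT : r ∈ formTangent B D := by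
    have := add_mem_formTangent hh (hN _ (N.neg_mem hk))
    rwa [add_neg_cancel_comm] at this
  have h1 := hcσ r ⟨hrT, hr⟩
  have e1 : D (k + r) u u = D r u u := by simp [hk u hu]
  have e2 : σ (k + r) = σ r := by simp [hNσ k hk]
  rw [e1, e2]
  calc D r u u ≤ ‖D r u u‖ := le_abs_self _
    _ ≤ ‖D r‖ * ‖u‖ * ‖u‖ := (D r).le_opNorm₂ u u
    _ ≤ (‖D‖ * ‖r‖) * ‖u‖ * ‖u‖ := by gcongr; exact D.le_opNorm r
    _ ≤ ((‖D‖ + 1) * (σ r / c)) * ‖u‖ * ‖u‖ := by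
        gcongr
        · linarith
        · rwa [le_div_iff₀ hc, mul_comm]
    _ = _ := by ring

/-- Square-root error bound for a linear matrix inequality at a solution where the minimised
functional is strictly complementary. -/
theorem exists_form_error_bound (hB : ∀ w, 0 ≤ B w w) (hBs : ∀ v w, B v w = B w v)
    (hsymm : ∀ h v w, D h v w = D h w v) (σ : X →L[ℝ] ℝ)
    (hσ : ∀ h ∈ formTangent B D, 0 ≤ σ h)
    (hσ0 : ∀ h ∈ formTangent B D, σ h = 0 → -h ∈ formTangent B D) :
    ∃ C > 0, ∃ ρ > 0, ∀ h, ‖h‖ < ρ → (∀ w, 0 ≤ B w w + D h w w) →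
      ∃ k, (∀ w, 0 ≤ B w w + D k w w) ∧ σ k = 0 ∧ ‖h - k‖ ≤ C * √(σ h) := by
  obtain ⟨C₁, hC₁, hD⟩ := exists_form_le_mul σ hσ hσ0
  let N : Submodule ℝ W := LinearMap.ker (B : W →ₗ[ℝ] W →L[ℝ] ℝ)
  -- `A h` keeps the rows of `D h` indexed by the kernel of `B`.
  let A : X →L[ℝ] N →L[ℝ] W →L[ℝ] ℝ :=
    (ContinuousLinearMap.compL ℝ N W (W →L[ℝ] ℝ)).flip N.subtypeL ∘L D
  have hA : ∀ h (u : N), A h u = D h u := fun h u => rfl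
  obtain ⟨C₂, hC₂, hk⟩ := exists_ker_norm_sub_le A
  obtain ⟨ρ₁, hρ₁, hρ⟩ := exists_forall_form_add_nonneg hB hBs
  set M := ‖B‖ + ‖D‖ + 1 with hM
  have hM0 : 0 < M := by positivity
  set C := C₂ * √(C₁ * M) with hC
  have hC0 : 0 < C := by positivity
  -- This quantity will bound `‖D k‖`; it must fall below `ρ₁` for `k` to be feasible.
  have hlim : Tendsto (fun h : X => ‖D‖ * (‖h‖ + C * √(σ h))) (𝓝 0) (𝓝 0) := by
    have : Continuous (fun h : X => ‖D‖ * (‖h‖ + C * √(σ h))) := by fun_prop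
    simpa using this.tendsto 0
  obtain ⟨ρ₂, hρ₂, hsmall⟩ := Metric.eventually_nhds_iff_ball.1 (hlim.eventually (gt_mem_nhds hρ₁))
  refine ⟨C, hC0, min ρ₂ 1, by positivity, fun h hh hpos => ?_⟩
  have hhT : h ∈ formTangent B D := fun u hu => by simpa [hu] using hpos u
  have hσh := hσ h hhT
  obtain ⟨k, hk0, hkn⟩ := hk h
  have hkD : ∀ u, B u = 0 → D k u = 0 := fun u hu => by
    rw [← hA k ⟨u, by simpa [N] using hu⟩, hk0]; rfl
  -- The square root arises here: Cauchy–Schwarz for `B + D h` pairs a diagonal entry of size `O(σ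
  -- h)` with one bounded by `M`, valid because `‖h‖ ≤ 1`.
  have hAn : ‖A h‖ ≤ √(C₁ * M) * √(σ h) := by
    refine ContinuousLinearMap.opNorm_le_bound₂ _ (by positivity) fun u w => ?_
    have hu : B (u : W) = 0 := by simp [N]
    have h1 := form_sq_le (B := B + D h) hpos
      (fun v w => by simp [hBs v w, hsymm h v w]) (u : W) w
    simp only [add_apply, hu, zero_add] at h1
    have h2 : B w w + D h w w ≤ M * ‖w‖ ^ 2 := by
      have h3 : B w w ≤ ‖B‖ * ‖w‖ * ‖w‖ := (le_abs_self _).trans (B.le_opNorm₂ w w)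
      have h4 : D h w w ≤ ‖D h‖ * ‖w‖ * ‖w‖ := (le_abs_self _).trans ((D h).le_opNorm₂ w w)
      have h5 : ‖D h‖ ≤ ‖D‖ := by
        refine (D.le_opNorm h).trans ?_
        have : ‖h‖ ≤ 1 := (hh.trans_le (min_le_right _ _)).le
        nlinarith [norm_nonneg D]
      have h6 : ‖D h‖ * (‖w‖ * ‖w‖) ≤ ‖D‖ * (‖w‖ * ‖w‖) := by gcongr
      nlinarith [sq_nonneg ‖w‖]
    have h7 : D h u w ^ 2 ≤ (C₁ * M) * σ h * (‖u‖ * ‖w‖) ^ 2 := by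
      calc _ ≤ _ := h1
        _ ≤ (C₁ * σ h * ‖(u : W)‖ ^ 2) * (M * ‖w‖ ^ 2) :=
          mul_le_mul (hD h hhT u hu) h2 (hpos w) (by positivity)
        _ = _ := by rw [Submodule.coe_norm]; ring
    rw [hA, Real.norm_eq_abs, ← Real.sqrt_sq_eq_abs]
    calc _ ≤ _ := Real.sqrt_le_sqrt h7
      _ = _ := by
        rw [Real.sqrt_mul (by positivity), Real.sqrt_mul (by positivity),
          Real.sqrt_sq (by positivity)]
        ring
  have hkn' : ‖h - k‖ ≤ C * √(σ h) := by
    refine hkn.trans ?_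
    rw [hC, mul_assoc]
    gcongr
  have hknorm : ‖k‖ ≤ ‖h‖ + C * √(σ h) := by
    have := norm_sub_norm_le k h
    rw [norm_sub_rev] at this
    linarith
  have hDk : ‖D k‖ < ρ₁ := by
    refine (D.le_opNorm k).trans_lt (lt_of_le_of_lt ?_
      (hsmall h (by simpa using hh.trans_le (min_le_left _ _))))
    gcongr
  refine ⟨k, hρ (D k) hDk (hsymm k) hkD, ?_, hkn'⟩
  -- Both `k` and `-k` are tangent, which forces `σ k = 0`.
  have h1 := hσ k (fun u hu => by simp [hkD u hu])
  have h2 := hσ (-k) (fun u hu => by simp [hkD u hu])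
  rw [map_neg] at h2
  linarith

end Forms

/-! ### Limiting subgradients of convex functions, and the relative interior. -/

section Subdifferential

variable {n : ℕ} {F : E n → EReal} {x ζ : E n}

/-- The subgradient inequality of convex analysis, tested on the epigraph. -/
def IsSubgradient (F : E n → EReal) (x ζ : E n) : Prop :=
  x ∈ dom F ∧ ∀ y (r : ℝ), F y ≤ r → (F x).toReal + inner ℝ ζ (y - x) ≤ r

theorem coe_toReal_of_mem_dom (hbot : ∀ x, F x ≠ ⊥) (hx : x ∈ dom F) :
    ((F x).toReal : EReal) = F x :=
  EReal.coe_toReal (ne_of_lt hx) (hbot x)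

/-- If the inequality failed at `(y, r)`, convexity would bound the difference quotient along the
segment from `x` to `y` by one negative constant, against the lower limit being nonnegative. -/
theorem isSubgradient_of_mem_regularSubdifferential (hbot : ∀ x, F x ≠ ⊥)
    (hconv : Convex ℝ (epi F)) (hζ : ζ ∈ regularSubdifferential F x) : IsSubgradient F x ζ := by
  obtain ⟨hx, hlim⟩ := hζ
  refine ⟨hx, fun y r hy => ?_⟩
  have hFx := coe_toReal_of_mem_dom hbot hx
  set a := (F x).toReal with ha
  by_contra! hlt
  rcases eq_or_ne y x with rfl | hyx
  · rw [← hFx, EReal.coe_le_coe_iff] at hy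
    simp at hlt
    linarith
  have hd : 0 < ‖y - x‖ := norm_pos_iff.2 (sub_ne_zero.2 hyx)
  set d := ‖y - x‖
  set c := inner ℝ ζ (y - x) with hc
  have ht : Tendsto (fun s : ℝ => x + s • (y - x)) (𝓝[>] 0) (𝓝[≠] x) := by
    refine tendsto_nhdsWithin_iff.2 ⟨?_, ?_⟩
    · have : Continuous (fun s : ℝ => x + s • (y - x)) := by fun_prop
      simpa using (this.tendsto 0).mono_left nhdsWithin_le_nhds
    · filter_upwards [self_mem_nhdsWithin] with s hs
      have hs0 : s ≠ 0 := ne_of_gt hs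
      simpa [hs0, sub_eq_zero] using hyx
  have hev : ∀ᶠ s : ℝ in 𝓝[>] 0, (fun z : E n =>
      (F z - F x - ((inner ℝ ζ (z - x) : ℝ) : EReal)) / ((‖z - x‖ : ℝ) : EReal))
        (x + s • (y - x)) ≤ (((r - a - c) / d : ℝ) : EReal) := by
    filter_upwards [Ioo_mem_nhdsGT (zero_lt_one' ℝ)] with s hs
    have hz : (x + s • (y - x), a + s * (r - a)) ∈ epi F := by
      have := hconv (x := (x, a)) (show F x ≤ (a : EReal) from hFx.ge)
        (y := (y, r)) (show F y ≤ (r : EReal) from hy)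
        (sub_nonneg.2 hs.2.le) hs.1.le (by ring)
      rwa [show (1 - s) • (x, a) + s • (y, r) = (x + s • (y - x), a + s * (r - a)) from
        Prod.ext (by simp only [Prod.fst_add, Prod.smul_fst]; module)
          (by simp only [Prod.snd_add, Prod.smul_snd, smul_eq_mul]; ring)] at this
    have hz' : F (x + s • (y - x)) ≤ ((a + s * (r - a) : ℝ) : EReal) := hz
    have hzr := coe_toReal_of_mem_dom hbot
      (show x + s • (y - x) ∈ dom F from hz'.trans_lt (EReal.coe_lt_top _))
    rw [← hzr, EReal.coe_le_coe_iff] at hz'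
    beta_reduce
    rw [← hzr, ← hFx, add_sub_cancel_left, norm_smul, inner_smul_right,
      Real.norm_eq_abs, abs_of_pos hs.1, ← EReal.coe_sub, ← EReal.coe_sub, ← EReal.coe_div, EReal.coe_le_coe_iff,
      div_le_div_iff₀ (mul_pos hs.1 hd) hd]
    have : (F (x + s • (y - x))).toReal - a - s * c ≤ s * (r - a - c) := by linarith
    calc _ ≤ s * (r - a - c) * d := by gcongr
      _ = _ := by ring
  have h1 := liminf_le_of_frequently_le' 
    (ht.frequently (p := fun z => (F z - F x - ((inner ℝ ζ (z - x) : ℝ) : EReal)) /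
      ((‖z - x‖ : ℝ) : EReal) ≤ (((r - a - c) / d : ℝ) : EReal)) hev.frequently)
  have h2 := hlim.trans h1
  rw [← EReal.coe_zero, EReal.coe_le_coe_iff] at h2
  have : (r - a - c) / d < 0 := div_neg_of_neg_of_pos (by linarith) hd
  linarith

theorem IsSubgradient.mem_regularSubdifferential (hbot : ∀ x, F x ≠ ⊥)
    (hζ : IsSubgradient F x ζ) : ζ ∈ regularSubdifferential F x := by
  refine ⟨hζ.1, le_liminf_of_le (by isBoundedDefault) (Eventually.of_forall fun z => ?_)⟩
  refine EReal.div_nonneg ?_ (EReal.coe_nonneg.2 (norm_nonneg _))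
  rw [← coe_toReal_of_mem_dom hbot hζ.1]
  rcases eq_or_ne (F z) ⊤ with h | h
  · rw [h, EReal.top_sub_coe, EReal.top_sub_coe]; exact le_top
  · have hz := coe_toReal_of_mem_dom hbot (show z ∈ dom F from lt_top_iff_ne_top.2 h)
    rw [← hz, ← EReal.coe_sub, ← EReal.coe_sub, EReal.coe_nonneg]
    linarith [hζ.2 z _ hz.ge]

/-- For a convex function the limiting subdifferential is the set of subgradients. -/
theorem mem_subdifferential_iff (hbot : ∀ x, F x ≠ ⊥) (hconv : Convex ℝ (epi F)) :
    ζ ∈ subdifferential F x ↔ IsSubgradient F x ζ := by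
  constructor
  · rintro ⟨hx, u, v, hu, hFu, hv, hreg⟩
    refine ⟨hx, fun y r hy => ?_⟩
    have h1 := (EReal.tendsto_toReal (ne_of_lt hx) (hbot x)).comp hFu
    refine le_of_tendsto (h1.add (hv.inner (hu.const_sub y)))
      (Eventually.of_forall fun k => ?_)
    exact (isSubgradient_of_mem_regularSubdifferential hbot hconv (hreg k)).2 y r hy
  · intro h
    exact ⟨h.1, fun _ => x, fun _ => ζ, tendsto_const_nhds, tendsto_const_nhds,
      tendsto_const_nhds, fun _ => h.mem_regularSubdifferential hbot⟩

/-- A point of the relative interior can be left in the direction opposite to any other point of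
the set. -/
theorem exists_neg_smul_mem_of_zero_mem_intrinsicInterior {S : Set (E n)}
    (h0 : 0 ∈ intrinsicInterior ℝ S) {v : E n} (hv : v ∈ S) : ∃ ε : ℝ, 0 < ε ∧ -(ε • v) ∈ S := by
  obtain ⟨y, hy, hy0⟩ := mem_intrinsicInterior.1 h0
  have hvs : v ∈ affineSpan ℝ S := subset_affineSpan ℝ S hv
  have h0s : (0 : E n) ∈ affineSpan ℝ S := hy0 ▸ y.2
  have hmem : ∀ ε : ℝ, -(ε • v) ∈ affineSpan ℝ S := fun ε => by
    simpa [AffineMap.lineMap_apply] using AffineMap.lineMap_mem (-ε) h0s hvs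
  let g : ℝ → affineSpan ℝ S := fun ε => ⟨-(ε • v), hmem ε⟩
  have hg : Continuous g := by fun_prop
  have hg0 : g 0 = y := Subtype.ext (by simp [g, hy0])
  have hev : ∀ᶠ ε in 𝓝 (0 : ℝ), g ε ∈ interior ((↑) ⁻¹' S : Set (affineSpan ℝ S)) :=
    hg.continuousAt.eventually_mem (hg0 ▸ isOpen_interior.mem_nhds hy)
  obtain ⟨ε, hε, hε0⟩ := ((hev.filter_mono nhdsWithin_le_nhds).and
    (self_mem_nhdsWithin (s := Set.Ioi (0 : ℝ)))).exists
  exact ⟨ε, hε0, interior_subset (s := ((↑) ⁻¹' S : Set (affineSpan ℝ S))) hε⟩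

end Subdifferential

/-! ### Finite sums of extended reals. -/

section Sums

variable {n : ℕ}

theorem sum_ne_bot {ι : Type*} {s : Finset ι} {a : ι → EReal} (h : ∀ i ∈ s, a i ≠ ⊥) :
    ∑ i ∈ s, a i ≠ ⊥ := by
  classical
  induction s using Finset.induction_on with
  | empty => simp
  | insert i s hi ih =>
    rw [Finset.sum_insert hi]
    have h1 := h i (Finset.mem_insert_self _ _)
    have h2 := ih fun j hj => h j (Finset.mem_insert_of_mem hj)
    simp [EReal.add_eq_bot_iff, h1, h2]

theorem ne_top_of_sum_ne_top {ι : Type*} {s : Finset ι} {a : ι → EReal} (h : ∀ i ∈ s, a i ≠ ⊥)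
    (hs : ∑ i ∈ s, a i ≠ ⊤) : ∀ i ∈ s, a i ≠ ⊤ := by
  classical
  intro i hi hit
  apply hs
  rw [← Finset.add_sum_erase s a hi, hit]
  exact EReal.top_add_of_ne_bot (sum_ne_bot fun j hj => h j (Finset.mem_of_mem_erase hj))

theorem coe_sum_eq {ι : Type*} (s : Finset ι) (a : ι → ℝ) :
    ((∑ i ∈ s, a i : ℝ) : EReal) = ∑ i ∈ s, (a i : EReal) := by
  classical
  induction s using Finset.induction_on with
  | empty => simp
  | insert i s hi ih => rw [Finset.sum_insert hi, Finset.sum_insert hi, EReal.coe_add, ih]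

/-- Addition of extended reals is discontinuous only where `⊥` meets `⊤`, which is excluded since no
term is `⊥`. -/
theorem lowerSemicontinuous_sum_ereal {ι : Type*} (s : Finset ι) {f : ι → E n → EReal}
    (hbot : ∀ i x, f i x ≠ ⊥) (hf : ∀ i, LowerSemicontinuous (f i)) :
    LowerSemicontinuous fun x => ∑ i ∈ s, f i x := by
  classical
  induction s using Finset.induction_on with
  | empty => simpa using lowerSemicontinuous_const
  | insert i s hi ih =>
    simp only [Finset.sum_insert hi]
    exact (hf i).add' ih fun x => EReal.continuousAt_add
      (Or.inr (sum_ne_bot fun j _ => hbot j x)) (Or.inl (hbot i x))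

end Sums

/-! ### Feasible displacements and tangent directions under strict feasibility. -/

section Feasible

variable {X W : Type*} [NormedAddCommGroup X] [NormedSpace ℝ X]
  [NormedAddCommGroup W] [NormedSpace ℝ W]
  {B : W →L[ℝ] W →L[ℝ] ℝ} {D : X →L[ℝ] W →L[ℝ] W →L[ℝ] ℝ}

/-- The displacements along which the affine family of forms `B + D k` is positive semidefinite. -/
def formFeasible (B : W →L[ℝ] W →L[ℝ] ℝ) (D : X →L[ℝ] W →L[ℝ] W →L[ℝ] ℝ) : Set X :=
  {k | ∀ w, 0 ≤ B w w + D k w w}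

theorem formFeasible_subset_formTangent : formFeasible B D ⊆ formTangent B D :=
  fun k hk u hu => by simpa [hu] using hk u

/-- The Slater direction `e` is positive definite on the kernel of `B`, so adding `δ • e` makes a
tangent direction strictly positive there and short steps stay feasible. As `δ → 0`, tangent
directions are limits of feasible ones. -/
theorem exists_pos_forall_smul_mem_formFeasible [FiniteDimensional ℝ W] (hB : ∀ w, 0 ≤ B w w)
    (hBs : ∀ v w, B v w = B w v) {e : X} (he : ∀ w, w ≠ 0 → 0 < B w w + D e w w) {h : X}
    (hh : h ∈ formTangent B D) {δ : ℝ} (hδ : 0 < δ) :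
    ∃ s₀ > 0, ∀ s : ℝ, 0 < s → s ≤ s₀ → s • (h + δ • e) ∈ formFeasible B D := by
  obtain ⟨s₀, hs₀, H⟩ := exists_forall_form_add_smul_nonneg (D := D (h + δ • e)) hB hBs (by
    intro u hu0 hu
    have h1 := hh u hu
    have h2 := he u hu0
    simp only [hu, zero_apply, zero_add] at h2
    simp only [map_add, map_smul, add_apply, smul_apply, smul_eq_mul]
    positivity)
  refine ⟨s₀, hs₀, fun s hs hs' w => ?_⟩
  have := H s hs hs' w
  rwa [map_smul, smul_apply, smul_apply, smul_eq_mul]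

theorem nonneg_of_forall_pos_add_mul_nonneg {a b : ℝ} (h : ∀ δ > 0, 0 ≤ a + δ * b) : 0 ≤ a := by
  have ht : Tendsto (fun δ : ℝ => a + δ * b) (𝓝[>] 0) (𝓝 a) := by
    have : Continuous (fun δ : ℝ => a + δ * b) := by fun_prop
    simpa using (this.tendsto 0).mono_left nhdsWithin_le_nhds
  exact ge_of_tendsto ht (eventually_nhdsWithin_of_forall h)

/-- A linear functional nonnegative on the feasible displacements is nonnegative on the tangent
cone. -/
theorem nonneg_on_formTangent [FiniteDimensional ℝ W] (hB : ∀ w, 0 ≤ B w w)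
    (hBs : ∀ v w, B v w = B w v) {e : X} (he : ∀ w, w ≠ 0 → 0 < B w w + D e w w)
    (l : X →L[ℝ] ℝ) (hl : ∀ k ∈ formFeasible B D, 0 ≤ l k) {h : X} (hh : h ∈ formTangent B D) :
    0 ≤ l h := by
  refine nonneg_of_forall_pos_add_mul_nonneg (b := l e) fun δ hδ => ?_
  obtain ⟨s, hs, H⟩ := exists_pos_forall_smul_mem_formFeasible hB hBs he hh hδ
  have := hl _ (H s hs le_rfl)
  simp only [map_smul, map_add, smul_eq_mul] at this
  exact nonneg_of_mul_nonneg_right this hs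

end Feasible

/-! ### Strict complementarity from the relative interior condition. -/

section Complementarity

variable {n : ℕ} {ι W : Type*} [Fintype ι] [NormedAddCommGroup W] [NormedSpace ℝ W]
  [FiniteDimensional ℝ W]
  {B : W →L[ℝ] W →L[ℝ] ℝ} {D : (E n × (ι → ℝ)) →L[ℝ] W →L[ℝ] W →L[ℝ] ℝ}

/-- The functional `(x, t) ↦ ∑ᵢ tᵢ`. -/
noncomputable def sumSnd (n : ℕ) (ι : Type*) [Fintype ι] : (E n × (ι → ℝ)) →L[ℝ] ℝ :=
  ∑ i, (ContinuousLinearMap.proj i).comp (ContinuousLinearMap.snd ℝ (E n) (ι → ℝ))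

theorem sumSnd_apply (k : E n × (ι → ℝ)) : sumSnd n ι k = ∑ i, k.2 i := by
  simp [sumSnd]

/-- The vectors `v` with `⟨v, x⟩ ≤ ∑ᵢ tᵢ` for every feasible displacement `(x, t)`. -/
def feasibleDual (B : W →L[ℝ] W →L[ℝ] ℝ) (D : (E n × (ι → ℝ)) →L[ℝ] W →L[ℝ] W →L[ℝ] ℝ) :
    Set (E n) :=
  {v | ∀ k ∈ formFeasible B D, inner ℝ v k.1 ≤ sumSnd n ι k}

/-- Replaces the feasible set by a closed convex cone, to which separation applies. -/
theorem mem_feasibleDual_iff (hB : ∀ w, 0 ≤ B w w) (hBs : ∀ v w, B v w = B w v)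
    {e : E n × (ι → ℝ)} (he : ∀ w, w ≠ 0 → 0 < B w w + D e w w) {v : E n} :
    v ∈ feasibleDual B D ↔ ∀ k ∈ formTangent B D, inner ℝ v k.1 ≤ sumSnd n ι k := by
  refine ⟨fun hv k hk => ?_, fun hv k hk => hv k (formFeasible_subset_formTangent hk)⟩
  have := nonneg_on_formTangent hB hBs he
    (sumSnd n ι - (innerSL ℝ v).comp (ContinuousLinearMap.fst ℝ (E n) (ι → ℝ)))
    (fun k hk => by simpa using hv k hk) hk
  simpa using this

/-- A vertical tangent direction along which the objective does not increase is zero. -/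
theorem eq_zero_of_vertical_mem_formTangent (hB : ∀ w, 0 ≤ B w w) (hBs : ∀ v w, B v w = B w v)
    {e : E n × (ι → ℝ)} (he : ∀ w, w ≠ 0 → 0 < B w w + D e w w)
    (hinf : ∀ x t t', (x, t) ∈ formFeasible B D → (x, t') ∈ formFeasible B D →
      (x, t ⊓ t') ∈ formFeasible B D)
    (h0 : 0 ∈ feasibleDual B D) {c : ι → ℝ} (hc : ((0 : E n), c) ∈ formTangent B D)
    (hc0 : ∑ i, c i ≤ 0) : c = 0 := by
  have hmin : 0 ≤ ∑ i, min (c i) 0 := by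
    refine nonneg_of_forall_pos_add_mul_nonneg (b := ∑ i, e.2 i) fun δ hδ => ?_
    obtain ⟨s, hs, H⟩ := exists_pos_forall_smul_mem_formFeasible hB hBs he hc hδ
    obtain ⟨s', hs', H'⟩ := exists_pos_forall_smul_mem_formFeasible hB hBs he
      (h := 0) (fun u hu => by simp) hδ
    have hm : 0 < min s s' := lt_min hs hs'
    have h1 := H _ hm (min_le_left _ _)
    have h2 := H' _ hm (min_le_right _ _)
    generalize min s s' = r at h1 h2 hm
    -- Perturbed copies of `(0, c)` and of `0` lie over the same base point, so their infimum is
    -- feasible and has nonnegative cost.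
    have h3 := h0 _ (hinf (r • δ • e.1) (r • (c + δ • e.2)) (r • δ • e.2)
      (by convert h1 using 1; ext <;> simp [mul_add]) (by convert h2 using 1; ext <;> simp))
    rw [inner_zero_left, sumSnd_apply] at h3
    refine nonneg_of_mul_nonneg_right (a := r) (h3.trans_eq ?_) hm
    rw [Finset.mul_sum, ← Finset.sum_add_distrib, Finset.mul_sum]
    refine Finset.sum_congr rfl fun i _ => ?_
    simp only [Pi.inf_apply, Pi.smul_apply, Pi.add_apply, smul_eq_mul]
    rcases le_total (c i) 0 with h | h
    · rw [min_eq_left h, min_eq_left (mul_le_mul_of_nonneg_left (by linarith) hm.le)]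
    · rw [min_eq_right h, min_eq_right (mul_le_mul_of_nonneg_left (by linarith) hm.le)]; ring
  have h1 : ∀ i, min (c i) 0 = 0 := fun i =>
    (Finset.sum_eq_zero_iff_of_nonpos (fun i _ => min_le_right (c i) 0)).1
      (le_antisymm (Finset.sum_nonpos fun i _ => min_le_right (c i) 0) hmin) i (Finset.mem_univ i)
  have h2 : ∀ i, 0 ≤ c i := fun i => min_eq_right_iff.1 (h1 i)
  funext i
  exact (Finset.sum_eq_zero_iff_of_nonneg fun i _ => h2 i).1
    (le_antisymm hc0 (Finset.sum_nonneg fun i _ => h2 i)) i (Finset.mem_univ i)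

/-- Strict complementarity: if `0` is a relative interior point of the set of subgradients, the
tangent directions of zero cost form a linear space. -/
theorem neg_mem_formTangent_of_sum_nonpos (hB : ∀ w, 0 ≤ B w w) (hBs : ∀ v w, B v w = B w v)
    {e : E n × (ι → ℝ)} (he : ∀ w, w ≠ 0 → 0 < B w w + D e w w)
    (hinf : ∀ x t t', (x, t) ∈ formFeasible B D → (x, t') ∈ formFeasible B D →
      (x, t ⊓ t') ∈ formFeasible B D)
    (h0 : 0 ∈ feasibleDual B D)
    (hri : ∀ v ∈ feasibleDual B D, ∃ ε : ℝ, 0 < ε ∧ -(ε • v) ∈ feasibleDual B D)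
    {h : E n × (ι → ℝ)} (hh : h ∈ formTangent B D) (hh0 : sumSnd n ι h ≤ 0) :
    -h ∈ formTangent B D := by
  let C : Set ((E n × (ι → ℝ)) × ℝ) := {q | q.1 ∈ formTangent B D ∧ sumSnd n ι q.1 ≤ q.2}
  let A : ((E n × (ι → ℝ)) × ℝ) →L[ℝ] E n × ℝ :=
    ((ContinuousLinearMap.fst ℝ (E n) (ι → ℝ)).comp
      (ContinuousLinearMap.fst ℝ (E n × (ι → ℝ)) ℝ)).prod
      (ContinuousLinearMap.snd ℝ (E n × (ι → ℝ)) ℝ)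
  have hA : ∀ q, A q = (q.1.1, q.2) := fun q => rfl
  have hCs : ∀ q ∈ C, ∀ s : ℝ, 0 ≤ s → s • q ∈ C := fun q hq s hs =>
    ⟨smul_mem_formTangent hq.1 hs, by
      simpa using mul_le_mul_of_nonneg_left hq.2 hs⟩
  have hCa : ∀ q ∈ C, ∀ q' ∈ C, q + q' ∈ C := fun q hq q' hq' =>
    ⟨add_mem_formTangent hq.1 hq'.1, by simpa using add_le_add hq.2 hq'.2⟩
  -- An element of `C` killed by `A` is a vertical direction of nonpositive cost, hence zero.
  have hclosed : IsClosed (A '' C) := by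
    refine isClosed_image_of_cone ?_ (fun q hq s hs => hCs q hq s hs.le) A ?_
    · exact (isClosed_formTangent.preimage continuous_fst).inter
        (isClosed_le (by fun_prop) continuous_snd)
    · rintro ⟨⟨x, τ⟩, s⟩ hq hq0
      rw [hA, Prod.mk_eq_zero] at hq0
      obtain ⟨rfl, rfl⟩ : x = 0 ∧ s = 0 := hq0
      have := eq_zero_of_vertical_mem_formTangent hB hBs he hinf h0 hq.1
        ((sumSnd_apply _).symm.trans_le hq.2)
      simp [this]
  have hconv : Convex ℝ (A '' C) := by
    refine Convex.linear_image (s := C) ?_ A.toLinearMap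
    intro q hq q' hq' a b ha hb _
    exact hCa _ (hCs q hq a ha) _ (hCs q' hq' b hb)
  -- Otherwise a separating functional gives `p` with `⟨p, h.1⟩ > 0` and a negative multiple of `p`
  -- in the dual set. By `hri` a positive multiple lies there too, which contradicts the nonpositive
  -- cost of `h`.
  have hmem : (-h.1, (0 : ℝ)) ∈ A '' C := by
    by_contra hnot
    obtain ⟨φ, r, hφ, hφr⟩ := geometric_hahn_banach_point_closed hconv hclosed hnot
    have hr0 : r < 0 := by
      have := hφr 0 ⟨0, ⟨fun u hu => by simp, by simp⟩, by simp⟩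
      simpa using this
    have hpos : ∀ q ∈ C, 0 ≤ φ (A q) := by
      intro q hq
      by_contra! hneg
      have h1 := hφr _ ⟨_, hCs q hq (r / φ (A q)) (div_nonneg_of_nonpos hr0.le hneg.le), rfl⟩
      rw [map_smul, map_smul, smul_eq_mul, div_mul_cancel₀ _ hneg.ne] at h1
      exact lt_irrefl _ h1
    set p : E n := (InnerProductSpace.toDual ℝ (E n)).symm
      (φ.comp (ContinuousLinearMap.inl ℝ (E n) ℝ)) with hp
    set b := φ (0, 1) with hb
    have hφp : ∀ x s, φ (x, s) = inner ℝ p x + s * b := by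
      intro x s
      have h1 : inner ℝ p x = φ (x, 0) := by
        rw [hp, InnerProductSpace.toDual_symm_apply]; rfl
      rw [h1, hb, ← smul_eq_mul, ← map_smul, ← map_add]
      simp
    have hb0 : 0 ≤ b := by
      have := hpos (0, 1) ⟨fun u hu => by simp, by simp⟩
      simpa [hA, ← hb] using this
    have hσ : ∀ k ∈ formTangent B D, 0 ≤ sumSnd n ι k := by
      simpa using (mem_feasibleDual_iff hB hBs he).1 h0
    -- The slope `b` may be zero; since costs are nonnegative, it can be enlarged to `b + 1` before
    -- dividing.
    have hv : -((b + 1)⁻¹ • p) ∈ feasibleDual B D := by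
      refine (mem_feasibleDual_iff hB hBs he).2 fun k hk => ?_
      have h1 := hpos (k, sumSnd n ι k) ⟨hk, le_rfl⟩
      rw [hA, hφp] at h1
      have h2 := hσ k hk
      rw [inner_neg_left, real_inner_smul_left, ← mul_neg, inv_mul_le_iff₀ (by positivity)]
      linarith
    obtain ⟨ε, hε, hεv⟩ := hri _ hv
    have h1 := (mem_feasibleDual_iff hB hBs he).1 hεv h hh
    rw [smul_neg, neg_neg, real_inner_smul_left, real_inner_smul_left] at h1
    have h2 : 0 < inner ℝ p h.1 := by
      have := hφ.trans hr0
      rw [hφp, inner_neg_right] at this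
      linarith
    have : 0 < ε * ((b + 1)⁻¹ * inner ℝ p h.1) := by positivity
    linarith
  obtain ⟨⟨⟨x, τ⟩, s⟩, hq, hqe⟩ := hmem
  rw [hA, Prod.mk.injEq] at hqe
  obtain ⟨rfl, rfl⟩ : x = -h.1 ∧ s = 0 := hqe
  -- The sum of `h` and `(-h.1, τ)` is vertical with nonpositive cost, hence zero.
  have hc := eq_zero_of_vertical_mem_formTangent hB hBs he hinf h0 (c := h.2 + τ)
    (by simpa [Prod.add_def] using add_mem_formTangent hh hq.1)
    (by
      have h1 : sumSnd n ι (-h.1, τ) ≤ 0 := hq.2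
      rw [sumSnd_apply] at h1 hh0
      simpa [Finset.sum_add_distrib] using add_nonpos hh0 h1)
  have : -h = (-h.1, τ) := Prod.ext rfl (eq_neg_of_add_eq_zero_right hc).symm
  rw [this]
  exact hq.1

end Complementarity

/-! ### From the error bound to the KL inequality. -/

section KL

variable {n : ℕ} {ι : Type*} [Fintype ι] {f : ι → E n → EReal}

theorem sum_le_coe_sum {x : E n} {t : ι → ℝ} (h : ∀ i, f i x ≤ (t i : EReal)) :
    ∑ i, f i x ≤ ((∑ i, t i : ℝ) : EReal) := by
  rw [coe_sum_eq]
  exact Finset.sum_le_sum fun i _ => h i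

theorem coe_toReal_of_sum_lt_top (hbot : ∀ i x, f i x ≠ ⊥) {x : E n} (hx : ∑ i, f i x < ⊤)
    (i : ι) : ((f i x).toReal : EReal) = f i x :=
  EReal.coe_toReal (ne_top_of_sum_ne_top (fun i _ => hbot i x) hx.ne i (Finset.mem_univ i))
    (hbot i x)

theorem sum_eq_coe_sum_toReal (hbot : ∀ i x, f i x ≠ ⊥) {x : E n} (hx : ∑ i, f i x < ⊤) :
    ∑ i, f i x = ((∑ i, (f i x).toReal : ℝ) : EReal) := by
  rw [coe_sum_eq]
  exact Finset.sum_congr rfl fun i _ => (coe_toReal_of_sum_lt_top hbot hx i).symm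

/-- Two points of the epigraph lift to the joint epigraph with the tight heights `f i x` and `f i
y`; combine them there and sum the heights. -/
theorem convex_epi_sum (hbot : ∀ i x, f i x ≠ ⊥)
    (hconv : Convex ℝ {p : E n × (ι → ℝ) | ∀ i, f i p.1 ≤ (p.2 i : EReal)}) :
    Convex ℝ (epi fun x => ∑ i, f i x) := by
  rintro ⟨x, r⟩ hx ⟨y, s⟩ hy a b ha hb hab
  have hx' : ∑ i, f i x ≤ (r : EReal) := hx
  have hy' : ∑ i, f i y ≤ (s : EReal) := hy
  have hxt := hx'.trans_lt (EReal.coe_lt_top r)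
  have hyt := hy'.trans_lt (EReal.coe_lt_top s)
  have h := hconv
    (x := (x, fun i => (f i x).toReal)) (fun i => (coe_toReal_of_sum_lt_top hbot hxt i).ge)
    (y := (y, fun i => (f i y).toReal)) (fun i => (coe_toReal_of_sum_lt_top hbot hyt i).ge)
    ha hb hab
  have h1 := sum_le_coe_sum h
  rw [sum_eq_coe_sum_toReal hbot hxt, EReal.coe_le_coe_iff] at hx'
  rw [sum_eq_coe_sum_toReal hbot hyt, EReal.coe_le_coe_iff] at hy'
  refine h1.trans (EReal.coe_le_coe_iff.2 ?_)
  simp only [Prod.smul_mk, Prod.mk_add_mk, Pi.add_apply, Pi.smul_apply, smul_eq_mul,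
    Finset.sum_add_distrib, ← Finset.mul_sum]
  gcongr

/-- The square-root inequality `√(h x - h x₀) ≤ C ‖ζ‖` for subgradients `ζ ∈ ∂h(x)` near `x₀` is
the KL inequality with exponent `1/2`. -/
theorem klInequality_of_sqrt_le {h : E n → EReal} {x₀ : E n} {C : ℝ} (hC : 0 < C) {a : EReal}
    (ha : 0 < a) {V : Set (E n)} (hV : V ∈ 𝓝 x₀)
    (H : ∀ x ∈ V, h x₀ < h x → h x < h x₀ + a → 0 < (h x - h x₀).toReal ∧
      ∀ ζ ∈ subdifferential h x, √((h x - h x₀).toReal) ≤ C * ‖ζ‖) :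
    KLInequality h x₀ (fun s => 2 * C * s ^ (1 - (1 / 2 : ℝ))) := by
  refine ⟨a, ha, V, hV, fun x hx h1 h2 => ?_⟩
  obtain ⟨hs, hζ⟩ := H x hx h1 h2
  set s := (h x - h x₀).toReal
  have hsq : 0 < √s := Real.sqrt_pos.2 hs
  have hderiv : deriv (fun s : ℝ => 2 * C * s ^ (1 - (1 / 2 : ℝ))) s = C / √s := by
    have h3 : (fun s : ℝ => 2 * C * s ^ (1 - (1 / 2 : ℝ))) = fun s => 2 * C * √s := by
      funext s; rw [Real.sqrt_eq_rpow]; norm_num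
    rw [h3, ((Real.hasDerivAt_sqrt hs.ne').const_mul _).deriv]
    field_simp
  rw [hderiv]
  have h4 : ENNReal.ofReal (√s / C) ≤ Metric.infEDist 0 (subdifferential h x) := by
    rw [Metric.le_infEDist]
    intro ζ hm
    rw [edist_zero_left, ← ENNReal.ofReal_coe_nnreal, coe_nnnorm]
    refine ENNReal.ofReal_le_ofReal ?_
    rw [div_le_iff₀ hC, mul_comm]
    exact hζ ζ hm
  calc (1 : ENNReal) = ENNReal.ofReal (C / √s) * ENNReal.ofReal (√s / C) := by
        rw [← ENNReal.ofReal_mul (by positivity)]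
        rw [show C / √s * (√s / C) = 1 by field_simp, ENNReal.ofReal_one]
    _ ≤ _ := by gcongr

/-- The KL property with exponent `1/2` for a sum of functions whose epigraphs are jointly described
by a strictly feasible affine family of quadratic forms. -/
theorem hasKLExponent_sum {W : Type*} [NormedAddCommGroup W] [NormedSpace ℝ W]
    [FiniteDimensional ℝ W] {B₀ : W →L[ℝ] W →L[ℝ] ℝ}
    {D : (E n × (ι → ℝ)) →L[ℝ] W →L[ℝ] W →L[ℝ] ℝ}
    (hB₀s : ∀ v w, B₀ v w = B₀ w v) (hDs : ∀ h v w, D h v w = D h w v)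
    (hf : ∀ i, ProperClosed (f i))
    (hK : ∀ x t, (∀ i, f i x ≤ (t i : EReal)) ↔ ∀ w, 0 ≤ B₀ w w + D (x, t) w w)
    {ps : E n × (ι → ℝ)} (hs : ∀ w, w ≠ 0 → 0 < B₀ w w + D ps w w) {x₀ : E n}
    (hri : 0 ∈ intrinsicInterior ℝ (subdifferential (fun x => ∑ i, f i x) x₀)) :
    HasKLExponent (fun x => ∑ i, f i x) x₀ (1 / 2) := by
  set F : E n → EReal := fun x => ∑ i, f i x with hF
  have hbot : ∀ i x, f i x ≠ ⊥ := fun i => (hf i).1.2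
  have hFbot : ∀ x, F x ≠ ⊥ := fun x => sum_ne_bot fun i _ => hbot i x
  have hconv : Convex ℝ (epi F) := by
    refine convex_epi_sum hbot ?_
    have : {p : E n × (ι → ℝ) | ∀ i, f i p.1 ≤ (p.2 i : EReal)} =
        {p | ∀ w, 0 ≤ B₀ w w + D p w w} := by
      ext p; exact hK p.1 p.2
    rw [this]
    intro p hp q hq a b ha hb hab w
    have h1 := mul_nonneg ha (hp w)
    have h2 := mul_nonneg hb (hq w)
    simp only [map_add, map_smul, add_apply, smul_apply, smul_eq_mul]
    have h3 : B₀ w w = a * B₀ w w + b * B₀ w w := by rw [← add_mul, hab, one_mul]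
    linarith
  have h0sub : 0 ∈ subdifferential F x₀ := intrinsicInterior_subset hri
  have hx₀ : F x₀ < ⊤ := h0sub.1
  set t₀ : ι → ℝ := fun i => (f i x₀).toReal with ht₀
  have hft₀ : ∀ i, (t₀ i : EReal) = f i x₀ := coe_toReal_of_sum_lt_top hbot hx₀
  have hFx₀ : F x₀ = ((∑ i, t₀ i : ℝ) : EReal) := sum_eq_coe_sum_toReal hbot hx₀
  set p₀ : E n × (ι → ℝ) := (x₀, t₀) with hp₀
  set B := B₀ + D p₀ with hBdef
  have hfeas : ∀ k : E n × (ι → ℝ), k ∈ formFeasible B D ↔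
      ∀ i, f i (x₀ + k.1) ≤ ((t₀ i + k.2 i : ℝ) : EReal) := by
    intro k
    refine Iff.trans ?_ (hK (x₀ + k.1) (t₀ + k.2)).symm
    refine forall_congr' fun w => ?_
    rw [show ((x₀ + k.1, t₀ + k.2) : E n × (ι → ℝ)) = p₀ + k from rfl, map_add, hBdef]
    simp only [add_apply, add_assoc]
  have hB : ∀ w, 0 ≤ B w w := (hK x₀ t₀).1 fun i => (hft₀ i).ge
  have hBs : ∀ v w, B v w = B w v := fun v w => by simp [hBdef, hB₀s v w, hDs p₀ v w]
  have he : ∀ w, w ≠ 0 → 0 < B w w + D (ps - p₀) w w := fun w hw => by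
    have := hs w hw
    simp only [hBdef, map_sub, add_apply, sub_apply]
    linarith
  -- Each height is constrained only by its own summand, so heights may be minimised coordinatewise.
  have hinf : ∀ x t t', (x, t) ∈ formFeasible B D → (x, t') ∈ formFeasible B D →
      (x, t ⊓ t') ∈ formFeasible B D := by
    intro x t t' h h'
    rw [hfeas] at h h' ⊢
    intro i
    rcases le_total (t i) (t' i) with hl | hl
    · simpa [min_eq_left hl] using h i
    · simpa [min_eq_right hl] using h' i
  have hdual : ∀ v, v ∈ feasibleDual B D ↔ v ∈ subdifferential F x₀ := by
    intro v
    rw [mem_subdifferential_iff hFbot hconv]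
    have hreal : (F x₀).toReal = ∑ i, t₀ i := by rw [hFx₀, EReal.toReal_coe]
    constructor
    · intro hv
      refine ⟨hx₀, fun y r hy => ?_⟩
      have hyt : F y < ⊤ := hy.trans_lt (EReal.coe_lt_top r)
      have h1 := hv (y - x₀, fun i => (f i y).toReal - t₀ i) ((hfeas _).2 fun i => by
        simpa using (coe_toReal_of_sum_lt_top hbot hyt i).ge)
      rw [sumSnd_apply] at h1
      rw [show F y = _ from sum_eq_coe_sum_toReal hbot hyt, EReal.coe_le_coe_iff] at hy
      simp only [Finset.sum_sub_distrib] at h1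
      linarith
    · intro hv k hk
      have h1 := hv.2 (x₀ + k.1) _ (sum_le_coe_sum ((hfeas k).1 hk))
      rw [hreal, add_sub_cancel_left, Finset.sum_add_distrib] at h1
      rw [sumSnd_apply]
      linarith
  have h0 : 0 ∈ feasibleDual B D := (hdual 0).2 h0sub
  have hri' : ∀ v ∈ feasibleDual B D, ∃ ε : ℝ, 0 < ε ∧ -(ε • v) ∈ feasibleDual B D := by
    intro v hv
    obtain ⟨ε, hε, h⟩ := exists_neg_smul_mem_of_zero_mem_intrinsicInterior hri ((hdual v).1 hv)
    exact ⟨ε, hε, (hdual _).2 h⟩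
  obtain ⟨C, hC, ρ, hρ, hbound⟩ := exists_form_error_bound hB hBs hDs (sumSnd n ι)
    (by simpa using (mem_feasibleDual_iff hB hBs he).1 h0)
    (fun h hh hh0 => neg_mem_formTangent_of_sum_nonpos hB hBs he hinf h0 hri' hh hh0.le)
  refine ⟨⟨⟨⟨x₀, hx₀⟩, hFbot⟩, lowerSemicontinuous_sum_ereal _ hbot fun i => (hf i).2⟩,
    ⟨0, h0sub⟩, by norm_num, by norm_num, 2 * C, by positivity, ?_⟩
  -- The values `f i x` are close to `f i x₀` when `x` is close to `x₀` and `F x` is close to `F x₀`.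
  set N : ℝ := Fintype.card ι + 1 with hN
  have hN0 : 0 < N := by positivity
  -- Each `t i - t₀ i` exceeds `-η` and their sum is below `η`, so each is at most `η * N = ρ / 2`,
  -- inside the radius of the error bound.
  set η : ℝ := ρ / (2 * N) with hη
  have hη0 : 0 < η := by positivity
  have hηρ : η * N = ρ / 2 := by rw [hη]; field_simp
  have hlsc : ∀ᶠ x in 𝓝 x₀, ∀ i, ((t₀ i - η : ℝ) : EReal) < f i x :=
    eventually_all.2 fun i => (hf i).2 x₀ _ (by
      change ((t₀ i - η : ℝ) : EReal) < f i x₀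
      rw [← hft₀ i, EReal.coe_lt_coe_iff]; linarith)
  refine klInequality_of_sqrt_le hC (a := (η : EReal)) (by exact_mod_cast hη0)
    (hlsc.and (Metric.ball_mem_nhds x₀ hρ)) ?_
  rintro x ⟨hxl, hxρ⟩ hlt hlt'
  rw [hFx₀, ← EReal.coe_add] at hlt'
  have hxt : F x < ⊤ := hlt'.trans (EReal.coe_lt_top _)
  have hft : ∀ i, ((f i x).toReal : EReal) = f i x := coe_toReal_of_sum_lt_top hbot hxt
  set t : ι → ℝ := fun i => (f i x).toReal with ht
  have hFx : F x = ((∑ i, t i : ℝ) : EReal) := sum_eq_coe_sum_toReal hbot hxt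
  rw [hFx, EReal.coe_lt_coe_iff] at hlt'
  rw [hFx, hFx₀, EReal.coe_lt_coe_iff] at hlt
  rw [hFx, hFx₀, ← EReal.coe_sub, EReal.toReal_coe]
  refine ⟨sub_pos.2 hlt, fun ζ hζ => ?_⟩
  have hxl' : ∀ i, t₀ i - η < t i := fun i => by
    have := hxl i
    rwa [← hft i, EReal.coe_lt_coe_iff] at this
  have hup : ∀ i, t i - t₀ i ≤ η * N := by
    intro i
    have h1 : (t i - t₀ i + η) ≤ ∑ j, (t j - t₀ j + η) :=
      Finset.single_le_sum (f := fun j => t j - t₀ j + η)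
        (fun j _ => by linarith [hxl' j]) (Finset.mem_univ i)
    rw [Finset.sum_add_distrib, Finset.sum_sub_distrib, Finset.sum_const, Finset.card_univ,
      nsmul_eq_mul] at h1
    have : η * N = Fintype.card ι * η + η := by rw [hN]; ring
    linarith
  have hηN : η ≤ η * N := le_mul_of_one_le_right hη0.le (by rw [hN]; simp)
  obtain ⟨k, hk, hk0, hkn⟩ := hbound (x - x₀, fun i => t i - t₀ i) (by
    rw [Prod.norm_def, max_lt_iff]
    refine ⟨by simpa [dist_eq_norm] using hxρ, ?_⟩
    refine lt_of_le_of_lt ((pi_norm_le_iff_of_nonneg (r := ρ / 2) (by positivity)).2 fun i => ?_)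
      (half_lt_self hρ)
    rw [Real.norm_eq_abs, abs_le, ← hηρ]
    exact ⟨by linarith [hxl' i], hup i⟩) ((hfeas _).2 fun i => by simpa using (hft i).ge)
  rw [sumSnd_apply] at hk0 hkn
  simp only [Finset.sum_sub_distrib] at hkn
  set s := ∑ i, t i - ∑ i, t₀ i with hsdef
  have hs0 : 0 < s := sub_pos.2 hlt
  -- Test `ζ` at the minimiser `x₀ + k.1`: this gives `s ≤ ‖ζ‖ * (C * √s)`, and `√s` cancels.
  have h1 := ((mem_subdifferential_iff hFbot hconv).1 hζ).2 (x₀ + k.1) _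
    (sum_le_coe_sum ((hfeas k).1 hk))
  rw [hFx, EReal.toReal_coe, Finset.sum_add_distrib, hk0] at h1
  have h2 : ‖x - x₀ - k.1‖ ≤ C * √s := le_trans (le_max_left _ _) hkn
  have h3 : -inner ℝ ζ (x₀ + k.1 - x) ≤ ‖ζ‖ * (C * √s) := by
    rw [← inner_neg_right, show -(x₀ + k.1 - x) = x - x₀ - k.1 by abel]
    exact (real_inner_le_norm _ _).trans (by gcongr)
  have h4 : √s * √s ≤ (C * ‖ζ‖) * √s := by
    rw [Real.mul_self_sqrt hs0.le]
    calc s ≤ ‖ζ‖ * (C * √s) := by linarith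
      _ = _ := by ring
  exact le_of_mul_le_mul_right h4 (Real.sqrt_pos.2 hs0)

end KL

/-! ### From matrix inequalities to quadratic forms. -/

section FormRepresentation

variable {n : ℕ}

/-- `h` is representable by quadratic forms, strictly feasibly over the point `xs`: there is an affine
family of symmetric bilinear forms on some `ℝᵏ`, parametrised by `ℝⁿ × ℝ`, such that `epi h` is the
set of parameters with positive semidefinite form, and such that the form is positive definite at
some point over `xs`. -/
def FormRepresentable (h : E n → EReal) (xs : E n) : Prop :=
  ∃ (k : ℕ) (B : E k →L[ℝ] E k →L[ℝ] ℝ) (D : (E n × ℝ) →L[ℝ] E k →L[ℝ] E k →L[ℝ] ℝ),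
    (∀ v w, B v w = B w v) ∧ (∀ p v w, D p v w = D p w v) ∧
    (∀ x (t : ℝ), h x ≤ t ↔ ∀ w, 0 ≤ B w w + D (x, t) w w) ∧
    ∃ s : ℝ, ∀ w, w ≠ 0 → 0 < B w w + D (xs, s) w w

/-- A choice of coordinates permits forms on any finite-dimensional space, such as `Fin d → ℝ` or `E
p × ℝ`. -/
theorem FormRepresentable.of_bilin {V : Type*} [AddCommGroup V] [Module ℝ V]
    [FiniteDimensional ℝ V] {h : E n → EReal} {xs : E n} (b : LinearMap.BilinForm ℝ V)
    (d : (E n × ℝ) →ₗ[ℝ] LinearMap.BilinForm ℝ V)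
    (hb : ∀ v w, b v w = b w v) (hd : ∀ p v w, d p v w = d p w v)
    (hrep : ∀ x (t : ℝ), h x ≤ t ↔ ∀ w, 0 ≤ b w w + d (x, t) w w)
    (hs : ∃ s : ℝ, ∀ w, w ≠ 0 → 0 < b w w + d (xs, s) w w) : FormRepresentable h xs := by
  let k := Module.finrank ℝ V
  let e : E k ≃ₗ[ℝ] V := LinearEquiv.ofFinrankEq _ _ (by simp [k])
  let c : LinearMap.BilinForm ℝ V →ₗ[ℝ] E k →L[ℝ] E k →L[ℝ] ℝ :=
    { toFun := fun a => LinearMap.toContinuousLinearMap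
        ((LinearMap.toContinuousLinearMap (𝕜 := ℝ) (E := E k) (F' := ℝ)).toLinearMap ∘ₗ
          a.compl₁₂ e.toLinearMap e.toLinearMap)
      map_add' := fun a a' => by ext v w; simp
      map_smul' := fun r a => by ext v w; simp }
  have hc : ∀ a v w, c a v w = a (e v) (e w) := fun a v w => rfl
  have hcd : ∀ p v w, LinearMap.toContinuousLinearMap (c ∘ₗ d) p v w = d p (e v) (e w) :=
    fun p v w => rfl
  refine ⟨k, c b, LinearMap.toContinuousLinearMap (c ∘ₗ d), fun v w => ?_, fun p v w => ?_,
    fun x t => ?_, ?_⟩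
  · rw [hc, hc, hb]
  · rw [hcd, hcd, hd]
  · rw [hrep]
    simp only [hc, hcd]
    exact (e.surjective.forall (p := fun w => 0 ≤ b w w + d (x, t) w w))
  · obtain ⟨s, hs⟩ := hs
    exact ⟨s, fun w hw => by rw [hc, hcd]; exact hs _ (by simpa using hw)⟩

/-- The KL property with exponent `1/2` for sums of form-representable functions that are strictly
feasible over a common point. -/
theorem hasKLExponent_sum_of_formRepresentable {ι : Type*} [Fintype ι] {f : ι → E n → EReal}
    {xs : E n} (hf : ∀ i, ProperClosed (f i)) (hrep : ∀ i, FormRepresentable (f i) xs) {x₀ : E n}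
    (hri : 0 ∈ intrinsicInterior ℝ (subdifferential (fun x => ∑ i, f i x) x₀)) :
    HasKLExponent (fun x => ∑ i, f i x) x₀ (1 / 2) := by
  classical
  choose k B D hB hD hepi s hs using hrep
  let W := (i : ι) → E (k i)
  let pr : (i : ι) → W →L[ℝ] E (k i) := fun i => ContinuousLinearMap.proj i
  -- Block-diagonal sum: block `i` depends on `x` and `t i` alone, and testing on `Pi.single i w`
  -- recovers it.
  let B₀ : W →L[ℝ] W →L[ℝ] ℝ := ∑ i, (B i).bilinearComp (pr i) (pr i)
  let D₀ : (E n × (ι → ℝ)) →L[ℝ] W →L[ℝ] W →L[ℝ] ℝ := LinearMap.toContinuousLinearMap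
    { toFun := fun p => ∑ i, (D i (p.1, p.2 i)).bilinearComp (pr i) (pr i)
      map_add' := fun p q => by
        ext v w
        have h : ∀ i, D i (p.1 + q.1, p.2 i + q.2 i) = D i (p.1, p.2 i) + D i (q.1, q.2 i) :=
          fun i => by rw [← map_add]; rfl
        simp [h, Finset.sum_add_distrib]
      map_smul' := fun r p => by
        ext v w
        have h : ∀ i, D i (r • p.1, r * p.2 i) = r • D i (p.1, p.2 i) :=
          fun i => by rw [← map_smul]; rfl
        simp [h, Finset.mul_sum] }
  have hB₀ : ∀ v w, B₀ v w = ∑ i, B i (v i) (w i) := fun v w => by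
    simp only [B₀, pr, sum_apply, ContinuousLinearMap.bilinearComp_apply]; rfl
  have hD₀ : ∀ p v w, D₀ p v w = ∑ i, D i (p.1, p.2 i) (v i) (w i) := fun p v w => by
    simp only [D₀, pr, LinearMap.coe_toContinuousLinearMap', LinearMap.coe_mk, AddHom.coe_mk,
      sum_apply, ContinuousLinearMap.bilinearComp_apply]; rfl
  refine hasKLExponent_sum (B₀ := B₀) (D := D₀) (ps := (xs, s))
    (fun v w => by rw [hB₀, hB₀]; exact Finset.sum_congr rfl fun i _ => hB i _ _)
    (fun p v w => by rw [hD₀, hD₀]; exact Finset.sum_congr rfl fun i _ => hD i _ _ _)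
    hf (fun x t => ?_) (fun w hw => ?_) hri
  · constructor
    · intro h w
      rw [hB₀, hD₀, ← Finset.sum_add_distrib]
      exact Finset.sum_nonneg fun i _ => (hepi i x (t i)).1 (h i) (w i)
    · intro h i
      refine (hepi i x (t i)).2 fun w => ?_
      have h1 := h (Pi.single i w)
      rw [hB₀, hD₀, ← Finset.sum_add_distrib, Finset.sum_eq_single i] at h1
      · simpa using h1
      · intro j _ hj
        simp [Pi.single_eq_of_ne hj]
      · simp
  · obtain ⟨i, hi⟩ := Function.ne_iff.1 hw
    rw [hB₀, hD₀, ← Finset.sum_add_distrib]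
    refine Finset.sum_pos' (fun j _ => ?_) ⟨i, Finset.mem_univ i, hs i _ hi⟩
    rcases eq_or_ne (w j) 0 with h | h
    · simp [h]
    · exact (hs j _ h).le

/-- A linear matrix inequality is an inequality of quadratic forms. -/
theorem IsLMIRepresentation.formRepresentable {d : ℕ} {h : E n → EReal}
    {A₀₀ A₀ : Matrix (Fin d) (Fin d) ℝ} {A : Fin n → Matrix (Fin d) (Fin d) ℝ}
    (hA : IsLMIRepresentation h A₀₀ A₀ A) {xs : E n} {s : ℝ}
    (hs : (pencil A₀₀ A₀ A xs s).PosDef) : FormRepresentable h xs := by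
  let L : (E n × ℝ) →ₗ[ℝ] Matrix (Fin d) (Fin d) ℝ :=
    { toFun := fun p => ∑ j, p.1 j • A j + p.2 • A₀
      map_add' := fun p q => by
        simp only [Prod.fst_add, Prod.snd_add, PiLp.add_apply, add_smul, Finset.sum_add_distrib]
        abel
      map_smul' := fun r p => by
        simp [mul_smul, Finset.smul_sum] }
  have hL : ∀ x t, pencil A₀₀ A₀ A x t = A₀₀ + L (x, t) := fun x t => add_assoc _ _ _
  have hLs : ∀ p, (L p).IsSymm := fun p => by
    simp only [Matrix.IsSymm, L, LinearMap.coe_mk, AddHom.coe_mk, Matrix.transpose_add,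
      Matrix.transpose_sum, Matrix.transpose_smul, hA.symm₀.eq, (hA.symm _).eq]
  have happ : ∀ (M : Matrix (Fin d) (Fin d) ℝ) v w, Matrix.toBilin' M v w = v ⬝ᵥ M.mulVec w :=
    fun M v w => Matrix.toBilin'_apply' M v w
  have hsym : ∀ M : Matrix (Fin d) (Fin d) ℝ, M.IsSymm →
      ∀ v w, Matrix.toBilin' M v w = Matrix.toBilin' M w v := fun M hM v w => by
    rw [happ, happ, dotProduct_comm, Matrix.dotProduct_mulVec, ← Matrix.mulVec_transpose, hM.eq]
  have hq : ∀ x t w, Matrix.toBilin' A₀₀ w w + Matrix.toBilin' (L (x, t)) w w =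
      w ⬝ᵥ (pencil A₀₀ A₀ A x t).mulVec w := fun x t w => by
    rw [happ, happ, hL, Matrix.add_mulVec, dotProduct_add]
  have hherm : ∀ x t, (pencil A₀₀ A₀ A x t).IsHermitian := fun x t => by
    rw [hL]
    exact (hA.symm₀₀.add (hLs _))
  refine FormRepresentable.of_bilin (V := Fin d → ℝ) (Matrix.toBilin' A₀₀)
    (Matrix.toBilin'.toLinearMap ∘ₗ L) (hsym _ hA.symm₀₀) (fun p => hsym _ (hLs p))
    (fun x t => ?_) ⟨s, fun w hw => ?_⟩
  · have h1 : h x ≤ t ↔ (pencil A₀₀ A₀ A x t).PosSemidef := by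
      have := Set.ext_iff.1 hA.epi_eq (x, t)
      exact this
    rw [h1, Matrix.posSemidef_iff_dotProduct_mulVec]
    refine (and_iff_right (hherm x t)).trans (forall_congr' fun w => ?_)
    rw [star_trivial, ← hq]; rfl
  · have := hs.dotProduct_mulVec_pos hw
    rwa [star_trivial, ← hq] at this

end FormRepresentation

/-! ### Quadratic forms for the Lasso models. -/

section Lasso

variable {n p : ℕ}

/-- The symmetric form with matrix `[a I, y; yᵀ, c]` on `ℝᵖ × ℝ`, as a linear function of
`(a, y, c)`. -/
noncomputable def borderedForm (p : ℕ) :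
    (ℝ × E p × ℝ) →ₗ[ℝ] LinearMap.BilinForm ℝ (E p × ℝ) where
  toFun q := LinearMap.mk₂ ℝ (fun v w =>
      q.1 * inner ℝ v.1 w.1 + v.2 * inner ℝ w.1 q.2.1 + w.2 * inner ℝ v.1 q.2.1 +
        q.2.2 * (v.2 * w.2))
    (fun v v' w => by simp only [Prod.fst_add, Prod.snd_add, inner_add_left]; ring)
    (fun c v w => by simp only [Prod.smul_fst, Prod.smul_snd, real_inner_smul_left, smul_eq_mul]; ring)
    (fun v w w' => by simp only [Prod.fst_add, Prod.snd_add, inner_add_left, inner_add_right]; ring)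
    (fun c v w => by
      simp only [Prod.smul_fst, Prod.smul_snd, real_inner_smul_left, real_inner_smul_right, smul_eq_mul]
      ring)
  map_add' q q' := by
    refine LinearMap.ext₂ fun v w => ?_
    simp only [LinearMap.mk₂_apply, LinearMap.add_apply, Prod.fst_add, Prod.snd_add,
      inner_add_right]
    ring
  map_smul' c q := by
    refine LinearMap.ext₂ fun v w => ?_
    simp only [LinearMap.mk₂_apply, LinearMap.smul_apply, Prod.smul_fst, Prod.smul_snd,
      real_inner_smul_right, smul_eq_mul, RingHom.id_apply]
    ring

theorem borderedForm_comm (q : ℝ × E p × ℝ) (v w : E p × ℝ) :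
    borderedForm p q v w = borderedForm p q w v := by
  simp only [borderedForm, LinearMap.coe_mk, AddHom.coe_mk, LinearMap.mk₂_apply,
    real_inner_comm v.1 w.1]
  ring

theorem borderedForm_self (a c : ℝ) (y : E p) (v : E p × ℝ) :
    borderedForm p (a, y, c) v v = a * ‖v.1‖ ^ 2 + 2 * (v.2 * inner ℝ v.1 y) + c * v.2 ^ 2 := by
  simp only [borderedForm, LinearMap.coe_mk, AddHom.coe_mk, LinearMap.mk₂_apply,
    real_inner_self_eq_norm_sq]
  ring

/-- Completing the square, that is, the Schur complement of the identity block. -/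
theorem borderedForm_one (y : E p) (t : ℝ) (v : E p × ℝ) :
    borderedForm p (1, y, 2 * t) v v =
      ‖v.1 + v.2 • y‖ ^ 2 + 2 * (t - 1 / 2 * ‖y‖ ^ 2) * v.2 ^ 2 := by
  rw [borderedForm_self, norm_add_sq_real, inner_smul_right, norm_smul, mul_pow,
    Real.norm_eq_abs, sq_abs]
  ring

theorem half_norm_sq_le_iff (y : E p) (t : ℝ) :
    1 / 2 * ‖y‖ ^ 2 ≤ t ↔ ∀ v, 0 ≤ borderedForm p (1, y, 2 * t) v v := by
  constructor
  · intro h v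
    rw [borderedForm_one]
    have : 0 ≤ t - 1 / 2 * ‖y‖ ^ 2 := sub_nonneg.2 h
    positivity
  · intro h
    -- This vector annihilates the completed square.
    have := h (-y, 1)
    rw [borderedForm_one] at this
    norm_num at this
    linarith

theorem norm_le_iff (y : E p) (t : ℝ) :
    ‖y‖ ≤ t ↔ ∀ v, 0 ≤ borderedForm p (t, y, t) v v := by
  constructor
  · rintro h ⟨u, s⟩
    rw [borderedForm_self]
    have h1 : |s * inner ℝ u y| ≤ |s| * (‖u‖ * t) := by
      rw [abs_mul]
      gcongr
      exact (abs_real_inner_le_norm u y).trans (by gcongr)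
    have h2 := neg_le_of_abs_le h1
    have h3 : 0 ≤ t * (‖u‖ - |s|) ^ 2 := mul_nonneg ((norm_nonneg y).trans h) (sq_nonneg _)
    have h4 : t * (‖u‖ - |s|) ^ 2 = t * ‖u‖ ^ 2 - 2 * (|s| * (‖u‖ * t)) + t * |s| ^ 2 := by ring
    rw [sq_abs] at h4
    linarith
  · intro h
    rcases eq_or_ne y 0 with rfl | hy
    · simpa [borderedForm_self] using h (0, 1)
    · have hn : ‖y‖ ≠ 0 := norm_ne_zero_iff.2 hy
      -- The unit vector opposite to `y` is extremal: the form takes the value `2 * t - 2 * ‖y‖`.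
      have h1 := h (-(‖y‖⁻¹ • y), 1)
      rw [borderedForm_self] at h1
      simp only [norm_neg, norm_smul, norm_inv, norm_norm, inv_mul_cancel₀ hn, inner_neg_left,
        real_inner_smul_left, real_inner_self_eq_norm_sq] at h1
      have h2 : ‖y‖⁻¹ * ‖y‖ ^ 2 = ‖y‖ := by field_simp
      rw [h2] at h1
      linarith

theorem formRepresentable_half_norm_sq (l : E n →ₗ[ℝ] E p) (b : E p) (xs : E n) :
    FormRepresentable (fun x => ((1 / 2 * ‖l x - b‖ ^ 2 : ℝ) : EReal)) xs := by
  let L : (E n × ℝ) →ₗ[ℝ] ℝ × E p × ℝ :=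
    (0 : (E n × ℝ) →ₗ[ℝ] ℝ).prod
      ((l ∘ₗ LinearMap.fst ℝ (E n) ℝ).prod ((2 : ℝ) • LinearMap.snd ℝ (E n) ℝ))
  have hL : ∀ x t v, borderedForm p (1, -b, 0) v v + (borderedForm p ∘ₗ L) (x, t) v v =
      borderedForm p (1, l x - b, 2 * t) v v := fun x t v => by
    rw [LinearMap.comp_apply, ← LinearMap.add_apply, ← LinearMap.add_apply, ← map_add]
    congr 3
    simp [L, sub_eq_neg_add]
  refine .of_bilin (borderedForm p (1, -b, 0)) (borderedForm p ∘ₗ L) (borderedForm_comm _)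
    (fun q => borderedForm_comm _) (fun x t => ?_)
    -- Raising the height by `1 / 2` makes the Schur complement equal to `1`.
    ⟨1 / 2 * ‖l xs - b‖ ^ 2 + 1 / 2, fun v hv => ?_⟩
  · simp only [hL, EReal.coe_le_coe_iff]
    exact half_norm_sq_le_iff _ _
  · rw [hL, borderedForm_one]
    rcases eq_or_ne v.2 0 with h | h
    · have : v.1 ≠ 0 := fun h1 => hv (Prod.ext h1 h)
      have : 0 < ‖v.1‖ ^ 2 := by positivity
      simp only [h, zero_smul, add_zero]
      linarith
    · have : 0 < v.2 ^ 2 := by positivity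
      nlinarith [sq_nonneg ‖v.1 + v.2 • (l xs - b)‖]

theorem formRepresentable_mul_norm (l : E n →ₗ[ℝ] E p) {w : ℝ} (hw : 0 ≤ w) (xs : E n) :
    FormRepresentable (fun x => ((w * ‖l x‖ : ℝ) : EReal)) xs := by
  let L : (E n × ℝ) →ₗ[ℝ] ℝ × E p × ℝ :=
    (LinearMap.snd ℝ (E n) ℝ).prod
      (((w • l) ∘ₗ LinearMap.fst ℝ (E n) ℝ).prod (LinearMap.snd ℝ (E n) ℝ))
  have hL : ∀ x t v, (0 : LinearMap.BilinForm ℝ (E p × ℝ)) v v + (borderedForm p ∘ₗ L) (x, t) v v =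
      borderedForm p (t, w • l x, t) v v := fun x t v => by
    rw [LinearMap.zero_apply, LinearMap.zero_apply, zero_add]; rfl
  have hn : ∀ x, w * ‖l x‖ = ‖w • l x‖ := fun _ => by
    rw [norm_smul, Real.norm_eq_abs, abs_of_nonneg hw]
  -- Raising the height by `1` adds `‖v.1‖ ^ 2 + v.2 ^ 2` to a semidefinite form.
  refine .of_bilin 0 (borderedForm p ∘ₗ L) (by simp)
    (fun q => borderedForm_comm _) (fun x t => ?_) ⟨‖w • l xs‖ + 1, fun v hv => ?_⟩
  · simp only [hL, EReal.coe_le_coe_iff, hn]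
    exact norm_le_iff _ _
  · rw [hL, borderedForm_self]
    have h1 := (norm_le_iff (w • l xs) _).1 le_rfl v
    rw [borderedForm_self] at h1
    rcases eq_or_ne v.2 0 with h | h
    · have : v.1 ≠ 0 := fun h1 => hv (Prod.ext h1 h)
      have : 0 < ‖v.1‖ ^ 2 := by positivity
      nlinarith
    · have : 0 < v.2 ^ 2 := by positivity
      nlinarith [sq_nonneg ‖v.1‖]

theorem properClosed_coe {g : E n → ℝ} (hg : Continuous g) :
    ProperClosed fun x => (g x : EReal) :=
  ⟨⟨⟨0, EReal.coe_lt_top _⟩, fun _ => EReal.coe_ne_bot _⟩,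
    (continuous_coe_real_ereal.comp hg).lowerSemicontinuous⟩

/-- The KL property with exponent `1/2` for a least squares loss with a sum of norms of linear
images as a regulariser. -/
theorem hasKLExponent_leastSquares_add_norms {ι : Type*} [Fintype ι]
    (A : Matrix (Fin p) (Fin n) ℝ) (b : E p) {r : ι → ℕ} (l : (i : ι) → E n →ₗ[ℝ] E (r i))
    {w : ι → ℝ} (hw : ∀ i, 0 ≤ w i) {F : E n → EReal}
    (hF : ∀ x, F x = ((leastSquares A b x + ∑ i, w i * ‖l i x‖ : ℝ) : EReal)) {x₀ : E n}
    (hri : 0 ∈ intrinsicInterior ℝ (subdifferential F x₀)) : HasKLExponent F x₀ (1 / 2) := by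
  let lA : E n →ₗ[ℝ] E p :=
    { toFun := fun x => WithLp.toLp 2 (A.mulVec x.ofLp)
      map_add' := fun x y => by simp [Matrix.mulVec_add]
      map_smul' := fun c x => by simp [Matrix.mulVec_smul] }
  let f : Option ι → E n → EReal := fun o x => match o with
    | none => ((1 / 2 * ‖lA x - b‖ ^ 2 : ℝ) : EReal)
    | some i => ((w i * ‖l i x‖ : ℝ) : EReal)
  obtain rfl : F = fun x => ∑ o, f o x := by
    funext x
    rw [hF, EReal.coe_add, coe_sum_eq, Fintype.sum_option]
    rfl
  -- All summands are finite everywhere, so strict feasibility holds over any common point.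
  refine hasKLExponent_sum_of_formRepresentable (xs := 0) (fun o => ?_) (fun o => ?_) hri
  · cases o with
    | none =>
      have := lA.continuous_of_finiteDimensional
      exact properClosed_coe (by fun_prop)
    | some i =>
      have := (l i).continuous_of_finiteDimensional
      exact properClosed_coe (by fun_prop)
  · cases o with
    | none => exact formRepresentable_half_norm_sq lA b 0
    | some i => exact formRepresentable_mul_norm (l i) (hw i) 0

/-- The extraction of a subvector as a linear map. -/
noncomputable def subvectorLinear {r : ℕ} (J : Finset (Fin n)) (hJ : J.card = r) :
    E n →ₗ[ℝ] E r where
  toFun := subvector J hJ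
  map_add' x y := by ext k; simp [subvector]
  map_smul' c x := by ext k; simp [subvector]

end Lasso
end KLLMI

/-- KL exponent `1/2` for sums of LMI-representable functions, with its application to the
overlapping group Lasso and the group fused Lasso. -/
theorem mainTheorem4 :
    (∀ (n m : ℕ) (f : Fin m → KLLMI.E n → EReal) (d : Fin m → ℕ)
      (A₀₀ A₀ : (i : Fin m) → Matrix (Fin (d i)) (Fin (d i)) ℝ)
      (A : (i : Fin m) → Fin n → Matrix (Fin (d i)) (Fin (d i)) ℝ),
      (∀ i, KLLMI.ProperClosed (f i)) →
      (∀ i, KLLMI.IsLMIRepresentation (f i) (A₀₀ i) (A₀ i) (A i)) →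
      (∃ (xs : KLLMI.E n) (ss : Fin m → ℝ),
        ∀ i, (KLLMI.pencil (A₀₀ i) (A₀ i) (A i) xs (ss i)).PosDef) →
      ∀ x₀ : KLLMI.E n, x₀ ∈ KLLMI.domSubdifferential (fun x => ∑ i, f i x) →
        0 ∈ intrinsicInterior ℝ (KLLMI.subdifferential (fun x => ∑ i, f i x) x₀) →
        KLLMI.HasKLExponent (fun x => ∑ i, f i x) x₀ (1 / 2)) ∧
    (∀ (n p s : ℕ) (A : Matrix (Fin p) (Fin n) ℝ) (b : KLLMI.E p)
      (J : Fin s → Finset (Fin n)) (w : Fin s → ℝ),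
      (∀ j, ∃ i, j ∈ J i) → (∀ i, 0 ≤ w i) →
      ∀ x₀ : KLLMI.E n,
        0 ∈ intrinsicInterior ℝ (KLLMI.subdifferential (KLLMI.groupLasso A b J w) x₀) →
        KLLMI.HasKLExponent (KLLMI.groupLasso A b J w) x₀ (1 / 2)) ∧
    (∀ (n p s r : ℕ) (A : Matrix (Fin p) (Fin n) ℝ) (b : KLLMI.E p)
      (J : Fin (s + 1) → Finset (Fin n)) (hJ : ∀ i, (J i).card = r)
      (w : Fin (s + 1) → ℝ) (ν : Fin s → ℝ),
      (∀ j, ∃ i, j ∈ J i) → (∀ i k, i ≠ k → Disjoint (J i) (J k)) →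
      (∀ i, 0 ≤ w i) → (∀ i, 0 ≤ ν i) →
      ∀ x₀ : KLLMI.E n,
        0 ∈ intrinsicInterior ℝ
          (KLLMI.subdifferential (KLLMI.groupFusedLasso A b J hJ w ν) x₀) →
        KLLMI.HasKLExponent (KLLMI.groupFusedLasso A b J hJ w ν) x₀ (1 / 2)) := by
  refine ⟨?_, ?_, ?_⟩
  · rintro n m f d A₀₀ A₀ A hf hA ⟨xs, ss, hs⟩ x₀ - hri
    exact KLLMI.hasKLExponent_sum_of_formRepresentable hf
      (fun i => (hA i).formRepresentable (hs i)) hri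
  · intro n p s A b J w _ hw x₀ hri
    exact KLLMI.hasKLExponent_leastSquares_add_norms A b
      (fun i => KLLMI.subvectorLinear (J i) rfl) hw (fun _ => rfl) hri
  · intro n p s r A b J hJ w ν _ _ hw hν x₀ hri
    -- Block norms and norms of successive differences are both norms of linear images; the disjoint
    -- sum indexes them together.
    refine KLLMI.hasKLExponent_leastSquares_add_norms A b (ι := Fin (s + 1) ⊕ Fin s)
      (r := fun _ => r) (w := Sum.elim w ν)
      (Sum.elim (fun i => KLLMI.subvectorLinear (J i) (hJ i))
        fun i => KLLMI.subvectorLinear (J i.succ) (hJ i.succ) -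
          KLLMI.subvectorLinear (J i.castSucc) (hJ i.castSucc))
      (by rintro (i | i); exacts [hw i, hν i]) (fun x => ?_) hri
    rw [Fintype.sum_sum_type, ← add_assoc]
    rfl
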